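/- All graphs are finite and simple. In a total-coloring of a connected graph $G$ (a coloring of its vertices and edges), a path is total-rainbow if its edges and its inner vertices have pairwise distinct colors; $trc(G)$ is the least number of colors in a total-coloring of $G$ for which every two distinct vertices are joined by a total-rainbow path. Let $G$ be a connected unicyclic graph (a connected graph containing exactly one cycle) of order $n$ which is not itself a cycle and whose unique cycle is a triangle $u_1u_2u_3$. Let $T_i$ be the component containing $u_i$ after the three edges of the triangle are deleted; it is a tree rooted at $u_i$, called nontrivial if it contains an edge. A leaf is a vertex of degree one in $G$, and the leaves of $T_i$ are the leaves of $G$ lying in $T_i$. For $i\in\{1,2,3\}$ and $j\ge 1$ let $\mathcal G_i^j$ be the class of such graphs $G$ having exactly $i$ nontrivial trees and exactly $j$ leaves. Further let - $B_3$ be a graph with exactly one nontrivial tree, that tree being a path with its root as an end; - ${\mathcal G_1^3}'$ be the class of graphs in $\mathcal G_1^3$ in which, $u$ being the root of the nontrivial tree, two of the three leaves are adjacent to a common vertex $w$ and the third leaf is adjacent to a vertex of the path from $u$ to $w$ (this path may consist of one vertex, and the third leaf may also be adjacent to $u$ or to $w$); and ${\mathcal G_1^3}''=\mathcal G_1^3\setminus{\mathcal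 G_1^3}'$; - ${\mathcal G_2^4}'$ be the class of graphs in $\mathcal G_2^4$ in which both nontrivial trees have exactly two leaves; - ${\mathcal G_2^4}''$ be the class of graphs in $\mathcal G_2^4$ in which some nontrivial tree has exactly three leaves, all adjacent to one common vertex; and ${\mathcal G_2^4}'''=\mathcal G_2^4\setminus({\mathcal G_2^4}'\cup{\mathcal G_2^4}'')$; - ${\mathcal G_2^5}'$ be the class of graphs in $\mathcal G_2^5$ in which some nontrivial tree has exactly three leaves, all adjacent to one common vertex. Then - $trc(G)=2n-5$ if $G\in\{B_3\}\cup\mathcal G_2^2$; - $trc(G)=2n-6$ if $G\in\mathcal G_1^2\cup\mathcal G_2^3\cup\mathcal G_3^3$; - $trc(G)=2n-7$ if $G\in{\mathcal G_1^3}'\cup{\mathcal G_2^4}'\cup{\mathcal G_2^4}''\cup\mathcal G_3^4$; - $trc(G)=2n-8$ if $G\in{\mathcal G_1^3}''\cup{\mathcal G_2^4}'''\cup{\mathcal G_2^5}'\cup\mathcal G_3^5$; - $trc(G)\le 2n-9$ otherwise. -/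

import Mathlib

namespace TotalRainbow

variable {V : Type*}

/-! ### Total-rainbow connection -/

/-- The internal (inner) vertices of a walk, in order. -/
def innerVertices {G : SimpleGraph V} {u v : V} (p : G.Walk u v) : List V :=
  p.support.tail.dropLast

/-- For a total-coloring with vertex colors `cv` and edge colors `ce`, the walk `p` is a
total-rainbow path: it is a path, and all its edges and inner vertices have pairwise distinct
colors. -/
def IsTotalRainbowPath {G : SimpleGraph V} {C : Type*} (cv : V → C) (ce : Sym2 V → C) {u v : V}
    (p : G.Walk u v) : Prop :=
  p.IsPath ∧ (p.edges.map ce ++ (innerVertices p).map cv).Nodup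

/-- The total-coloring `(cv, ce)` makes `G` total-rainbow connected. The values of `ce` on
unordered pairs that are not edges of `G` play no role. -/
def IsTRCColoring (G : SimpleGraph V) {C : Type*} (cv : V → C) (ce : Sym2 V → C) : Prop :=
  ∀ u v : V, u ≠ v → ∃ p : G.Walk u v, IsTotalRainbowPath cv ce p

/-- The total-rainbow connection number: the least number of colors in a total-coloring that makes
`G` total-rainbow connected. -/
noncomputable def trc (G : SimpleGraph V) : ℕ :=
  sInf {k : ℕ | ∃ (cv : V → Fin k) (ce : Sym2 V → Fin k), IsTRCColoring G cv ce}

/-! ### Unicyclic graphs and the trees hanging off the cycle -/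

/-- `s` is the edge set of a cycle of `G`. -/
def IsCycleEdgeSet (G : SimpleGraph V) (s : Set (Sym2 V)) : Prop :=
  ∃ (u : V) (p : G.Walk u u), p.IsCycle ∧ s = {e | e ∈ p.edges}

/-- `G` contains exactly one cycle (as a subgraph). -/
def IsUnicyclic (G : SimpleGraph V) : Prop :=
  ∃! s : Set (Sym2 V), IsCycleEdgeSet G s

/-- The circumference: the length of a longest cycle. -/
noncomputable def circumference (G : SimpleGraph V) : ℕ :=
  sSup {k : ℕ | ∃ (u : V) (p : G.Walk u u), p.IsCycle ∧ p.length = k}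

/-- The vertices lying on a cycle of `G`. -/
def cycleVertices (G : SimpleGraph V) : Set V :=
  {u | ∃ p : G.Walk u u, p.IsCycle}

/-- The edges lying on a cycle of `G`. -/
def cycleEdges (G : SimpleGraph V) : Set (Sym2 V) :=
  {e | ∃ (u : V) (p : G.Walk u u), p.IsCycle ∧ e ∈ p.edges}

/-- The graph obtained from `G` by deleting the edges lying on a cycle. -/
def cycleDeleted (G : SimpleGraph V) : SimpleGraph V :=
  G.deleteEdges (cycleEdges G)

/-- The vertex set of the component containing `u` after deletion of the cycle edges. For a
unicyclic graph and `u` on its cycle, this is the vertex set of the tree `T` rooted at `u`. -/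
def hangingTree (G : SimpleGraph V) (u : V) : Set V :=
  {v | (cycleDeleted G).Reachable u v}

/-- The vertices `u` of the cycle whose tree is nontrivial, i.e. contains at least one edge. -/
def nontrivialRoots (G : SimpleGraph V) : Set V :=
  {u | u ∈ cycleVertices G ∧ ∃ v ∈ hangingTree G u, ∃ w ∈ hangingTree G u, (cycleDeleted G).Adj v w}

/-- The leaves (pendent vertices) of `G`: the vertices of degree one. -/
def leaves (G : SimpleGraph V) : Set V :=
  {v | ∃! w, G.Adj v w}

/-- The leaves of `G` belonging to the tree rooted at `u`. -/
def treeLeaves (G : SimpleGraph V) (u : V) : Set V :=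
  leaves G ∩ hangingTree G u

/-! ### The graph classes -/

/-- `G` is a graph `B_ℓ`: the cycle has length `ℓ`, exactly one of the trees is nontrivial, and
that tree is a path having its root as an end. -/
def ClassB (ℓ : ℕ) (G : SimpleGraph V) : Prop :=
  IsUnicyclic G ∧ circumference G = ℓ ∧ ∃ u : V, nontrivialRoots G = {u} ∧
    ∃ (m : ℕ) (f : SimpleGraph.pathGraph (m + 2) ≃g (cycleDeleted G).induce (hangingTree G u)),
      (f 0 : V) = u

/-- Unicyclic, circumference 3, exactly `i` nontrivial trees, and exactly `j` leaves. -/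
def ClassG (i j : ℕ) (G : SimpleGraph V) : Prop :=
  IsUnicyclic G ∧ circumference G = 3 ∧ (nontrivialRoots G).ncard = i ∧ (leaves G).ncard = j

/-- The tree rooted at `u` is a broom with three bristles: it has exactly three leaves, and these
are adjacent to a common vertex. (So it consists of a path, possibly trivial, from `u` to
a vertex `w`, and three pendent edges at `w`.) -/
def IsTripleBroom (G : SimpleGraph V) (u : V) : Prop :=
  (treeLeaves G u).ncard = 3 ∧ ∃ w : V, ∀ x ∈ treeLeaves G u, G.Adj w x

/-- One nontrivial tree, three leaves `x, y, z`, where `x` and `y` are adjacent to a common vertex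
`w`, and `z` is adjacent to a vertex on the path from the root `u` to `w` (the path may be
trivial). -/
def ClassG13' (G : SimpleGraph V) : Prop :=
  ClassG 1 3 G ∧ ∃ u ∈ nontrivialRoots G, ∃ (w : V) (p : (cycleDeleted G).Walk u w) (x y z : V),
    p.IsPath ∧ x ∈ leaves G ∧ y ∈ leaves G ∧ z ∈ leaves G ∧ x ≠ y ∧ x ≠ z ∧ y ≠ z ∧
    G.Adj w x ∧ G.Adj w y ∧ ∃ s ∈ p.support, G.Adj s z

/-- The other graphs with one nontrivial tree and three leaves. -/
def ClassG13'' (G : SimpleGraph V) : Prop :=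
  ClassG 1 3 G ∧ ¬ ClassG13' G

/-- Two nontrivial trees, four leaves, two in each of the nontrivial trees. -/
def ClassG24' (G : SimpleGraph V) : Prop :=
  ClassG 2 4 G ∧ ∀ u ∈ nontrivialRoots G, (treeLeaves G u).ncard = 2

/-- Two nontrivial trees, four leaves, one of the trees being a broom with three bristles
(so the other one is a path with its root as an end). -/
def ClassG24'' (G : SimpleGraph V) : Prop :=
  ClassG 2 4 G ∧ ∃ u ∈ nontrivialRoots G, IsTripleBroom G u

/-- The other graphs with two nontrivial trees and four leaves. -/
def ClassG24''' (G : SimpleGraph V) : Prop :=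
  ClassG 2 4 G ∧ ¬ (ClassG24' G ∨ ClassG24'' G)

/-- Two nontrivial trees, five leaves, one of the trees being a broom with three bristles
(so the other one has exactly two leaves). -/
def ClassG25' (G : SimpleGraph V) : Prop :=
  ClassG 2 5 G ∧ ∃ u ∈ nontrivialRoots G, IsTripleBroom G u

/-- The class on which the value is `2n - 5`. -/
def Family5 (G : SimpleGraph V) : Prop :=
  ClassB 3 G ∨ ClassG 2 2 G

/-- The class on which the value is `2n - 6`. -/
def Family6 (G : SimpleGraph V) : Prop :=
  ClassG 1 2 G ∨ ClassG 2 3 G ∨ ClassG 3 3 G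

/-- The class on which the value is `2n - 7`. -/
def Family7 (G : SimpleGraph V) : Prop :=
  ClassG13' G ∨ ClassG24' G ∨ ClassG24'' G ∨ ClassG 3 4 G

/-- The class on which the value is `2n - 8`. -/
def Family8 (G : SimpleGraph V) : Prop :=
  ClassG13'' G ∨ ClassG24''' G ∨ ClassG25' G ∨ ClassG 3 5 G

end TotalRainbow

namespace TotalRainbow

open SimpleGraph Relation

variable {V : Type*}

/-! Let `N` be the number of bridges and cut vertices together. With `t` nontrivial trees and `ℓ`
leaves there are `n - 3` bridges and `n - 3 - ℓ + t` cut vertices, so `N = 2n - 6 + t - ℓ`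
(`ncard_treeElements`). In a total-rainbow connected coloring these elements have pairwise distinct
colors, since any two of them lie on every path between suitably chosen ends (`color_injOn`).
Conversely, one further color, given to the triangle edges and the remaining vertices, always
suffices, because a path needs at most one triangle edge (`trc_le_succ`). Hence `trc G` is `N` or `N
+ 1`, and everything rests on deciding when `N` colors are enough.

With only `N` colors, each triangle edge and each trivial root repeats the color of some bridge or
cut vertex. A rainbow path through that element cannot use the triangle edge of the same color; it
must detour through the third root, and then the colors of the other two triangle edges and of that
root must also be absent from the rest of the path. This restricts which leaves may lie below the
repeated elements (`exists_elements_of_one`, `exists_elements_of_two`). Conversely, bridges in the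
required position give a coloring (`trc_le_of_one`, `trc_le_of_two`).

The outcome depends on `t`, which is positive because `G` is not a cycle. For `t = 3`, `N` colors
always suffice: each triangle edge takes the color of the opposite root, a cut vertex. For `t = 2`
they suffice exactly when some tree has at least three leaves and is not a triple broom, and for `t
= 1` exactly when there are at least three leaves and `G` is not in `ClassG13'`. In the last two
cases three elements with disjoint sets of leaves below them serve the triangle edges, and a further
one is needed for the trivial roots. A fourth leaf provides it; with three leaves it must be the
bridge above the parent of a leaf, and the exceptional classes are those where this fails. -/

/-- `G` is a triangle on the vertex set `R` together with a forest whose trees are rooted in `R`;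
the forest is described by the parent function `par` and the depth function `dep`. -/
structure TriangleForest (G : SimpleGraph V) (R : Finset V) (par : V → V) (dep : V → ℕ) :
    Prop where
  card_roots : R.card = 3
  adj_iff : ∀ x y, G.Adj x y ↔
    (x ≠ y ∧ x ∈ R ∧ y ∈ R) ∨ (y ∉ R ∧ x = par y) ∨ (x ∉ R ∧ y = par x)
  dep_root : ∀ r ∈ R, dep r = 0
  dep_par : ∀ x, x ∉ R → dep x = dep (par x) + 1

/-- The descendants of `v`, including `v`. -/
def subtree (R : Finset V) (par : V → V) (v : V) : Set V :=
  {w | ReflTransGen (fun x y => x ∉ R ∧ y = par x) w v}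

/-! ### The descendant order -/

section Subtree

variable {R : Finset V} {par : V → V} {u v w : V}

theorem self_mem_subtree : v ∈ subtree R par v := ReflTransGen.refl

theorem subtree_trans (h : w ∈ subtree R par v) (h' : v ∈ subtree R par u) :
    w ∈ subtree R par u := ReflTransGen.trans h h'

theorem mem_subtree_par (h : v ∉ R) : v ∈ subtree R par (par v) :=
  ReflTransGen.single ⟨h, rfl⟩

theorem mem_subtree_of_par (h : w ∉ R) (h' : par w ∈ subtree R par v) : w ∈ subtree R par v :=
  subtree_trans (mem_subtree_par h) h'

theorem mem_subtree_iff : w ∈ subtree R par v ↔ w = v ∨ (w ∉ R ∧ par w ∈ subtree R par v) := by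
  constructor
  · intro h
    rcases ReflTransGen.cases_head h with h | ⟨c, ⟨h1, rfl⟩, h2⟩
    · exact Or.inl h
    · exact Or.inr ⟨h1, h2⟩
  · rintro (rfl | ⟨h1, h2⟩)
    · exact self_mem_subtree
    · exact mem_subtree_of_par h1 h2

theorem par_mem_subtree (h : w ∈ subtree R par v) (hne : w ≠ v) : par w ∈ subtree R par v :=
  ((mem_subtree_iff.1 h).resolve_left hne).2

theorem not_mem_roots_of_ne (h : w ∈ subtree R par v) (hne : w ≠ v) : w ∉ R :=
  ((mem_subtree_iff.1 h).resolve_left hne).1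

theorem eq_of_root_mem_subtree (h : w ∈ subtree R par v) (hw : w ∈ R) : w = v :=
  by_contra fun hne => not_mem_roots_of_ne h hne hw

/-- The step from a vertex to its parent is a function, so the ancestors of `w` form a chain. -/
theorem subtree_comparable (h : w ∈ subtree R par u) (h' : w ∈ subtree R par v) :
    u ∈ subtree R par v ∨ v ∈ subtree R par u :=
  ReflTransGen.total_of_right_unique
    (fun _ _ _ h1 h2 => h1.2.trans h2.2.symm) h h'

theorem root_unique (hu : u ∈ R) (hv : v ∈ R) (h : w ∈ subtree R par u)
    (h' : w ∈ subtree R par v) : u = v := by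
  rcases subtree_comparable h h' with h | h
  · exact eq_of_root_mem_subtree h hu
  · exact (eq_of_root_mem_subtree h hv).symm

end Subtree

/-! ### Depth, and walks crossing the boundary of a subtree -/

namespace TriangleForest

variable {G : SimpleGraph V} {R : Finset V} {par : V → V} {dep : V → ℕ} {u v w x y : V}

theorem dep_le (F : TriangleForest G R par dep) (h : w ∈ subtree R par v) : dep v ≤ dep w := by
  induction h using ReflTransGen.head_induction_on with
  | refl => exact le_rfl
  | head h _ ih =>
    obtain ⟨h1, rfl⟩ := h
    have := F.dep_par _ h1
    omega

theorem eq_of_dep (F : TriangleForest G R par dep) (h : w ∈ subtree R par v)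
    (h' : dep w ≤ dep v) : w = v := by
  rcases mem_subtree_iff.1 h with h | ⟨h1, h2⟩
  · exact h
  · have := F.dep_le h2
    have := F.dep_par _ h1
    omega

theorem subtree_antisymm (F : TriangleForest G R par dep) (h : w ∈ subtree R par v)
    (h' : v ∈ subtree R par w) : w = v :=
  F.eq_of_dep h (F.dep_le h')

theorem par_ne (F : TriangleForest G R par dep) (h : v ∉ R) : par v ≠ v := by
  intro e
  have := F.dep_par _ h
  rw [e] at this
  omega

theorem par_not_mem_subtree (F : TriangleForest G R par dep) (h : v ∉ R) :
    par v ∉ subtree R par v := by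
  intro h'
  have := F.dep_le h'
  have := F.dep_par _ h
  omega

theorem adj_par (F : TriangleForest G R par dep) (h : v ∉ R) : G.Adj v (par v) :=
  (F.adj_iff _ _).2 (Or.inr (Or.inr ⟨h, rfl⟩))

theorem adj_roots (F : TriangleForest G R par dep) (hu : u ∈ R) (hv : v ∈ R) (h : u ≠ v) :
    G.Adj u v :=
  (F.adj_iff _ _).2 (Or.inl ⟨h, hu, hv⟩)

theorem exists_root (F : TriangleForest G R par dep) (v : V) :
    ∃ r ∈ R, v ∈ subtree R par r := by
  induction h : dep v generalizing v with
  | zero =>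
    by_cases hv : v ∈ R
    · exact ⟨v, hv, self_mem_subtree⟩
    · have := F.dep_par _ hv
      omega
  | succ k ih =>
    by_cases hv : v ∈ R
    · exact ⟨v, hv, self_mem_subtree⟩
    · have := F.dep_par _ hv
      obtain ⟨r, hr, h'⟩ := ih (par v) (by omega)
      exact ⟨r, hr, mem_subtree_of_par hv h'⟩

/-- If the ends matched crosswise, each vertex would be the parent of the other, contradicting the
depths. -/
theorem edge_injective (F : TriangleForest G R par dep) (hv : v ∉ R) (hw : w ∉ R)
    (h : s(v, par v) = s(w, par w)) : v = w := by
  rcases Sym2.eq_iff.1 h with h | ⟨h1, h2⟩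
  · exact h.1
  · have e1 := F.dep_par _ hv
    have e2 := F.dep_par _ hw
    rw [h2] at e1
    rw [← h1] at e2
    omega

theorem edge_ne (hv : v ∉ R) (hx : x ∈ R) (hy : y ∈ R) : s(v, par v) ≠ s(x, y) := by
  intro h
  rcases Sym2.eq_iff.1 h with h | h
  · exact hv (h.1 ▸ hx)
  · exact hv (h.1 ▸ hy)

/-- An edge leaving a subtree starts at its top vertex. -/
theorem eq_of_adj (F : TriangleForest G R par dep) (h : G.Adj x y) (hx : x ∈ subtree R par v)
    (hy : y ∉ subtree R par v) : x = v ∧ ((v ∈ R ∧ y ∈ R) ∨ (v ∉ R ∧ y = par v)) := by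
  rcases (F.adj_iff _ _).1 h with ⟨_, h2, h3⟩ | ⟨h1, rfl⟩ | ⟨h1, rfl⟩
  · have := eq_of_root_mem_subtree hx h2
    subst this
    exact ⟨rfl, Or.inl ⟨h2, h3⟩⟩
  · exact absurd (mem_subtree_of_par h1 hx) hy
  · have : x = v := by_contra fun hne => hy (par_mem_subtree hx hne)
    subst this
    exact ⟨rfl, Or.inr ⟨h1, rfl⟩⟩

/-- For `v ∉ R` the edge to the parent is the only edge leaving the subtree of `v`. A trail uses it
at most once, hence exactly when the two ends are separated by it. -/
theorem mem_edges_iff (F : TriangleForest G R par dep) (hv : v ∉ R) (p : G.Walk x y)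
    (hp : p.IsTrail) :
    s(v, par v) ∈ p.edges ↔ ¬ (x ∈ subtree R par v ↔ y ∈ subtree R par v) := by
  induction p with
  | nil => simp
  | @cons a b c h p ih =>
    rw [Walk.isTrail_cons] at hp
    have ih := ih hp.1
    rw [Walk.edges_cons, List.mem_cons]
    by_cases he : s(v, par v) = s(a, b)
    · have hn : s(v, par v) ∉ p.edges := he ▸ hp.2
      have hiff : ¬ (a ∈ subtree R par v ↔ b ∈ subtree R par v) := by
        rcases Sym2.eq_iff.1 he with ⟨rfl, rfl⟩ | ⟨rfl, rfl⟩
        · have := F.par_not_mem_subtree hv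
          have := self_mem_subtree (R := R) (par := par) (v := v)
          tauto
        · have := F.par_not_mem_subtree hv
          have := self_mem_subtree (R := R) (par := par) (v := v)
          tauto
      tauto
    · have hiff : (a ∈ subtree R par v ↔ b ∈ subtree R par v) := by
        by_contra hc
        rcases (by tauto : (a ∈ subtree R par v ∧ b ∉ subtree R par v) ∨
          (b ∈ subtree R par v ∧ a ∉ subtree R par v)) with ⟨h1, h2⟩ | ⟨h1, h2⟩
        · obtain ⟨rfl, h3 | h3⟩ := F.eq_of_adj h h1 h2
          · exact hv h3.1
          · exact he (by rw [h3.2])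
        · obtain ⟨rfl, h3 | h3⟩ := F.eq_of_adj h.symm h1 h2
          · exact hv h3.1
          · exact he (by rw [h3.2, Sym2.eq_swap])
      tauto

/-- A trail with both ends outside would have to enter and leave the subtree through the same
bridge. -/
theorem mem_subtree_of_mem_support (F : TriangleForest G R par dep) (hv : v ∉ R) (p : G.Walk x y)
    (hp : p.IsTrail) (h : v ∈ p.support) : x ∈ subtree R par v ∨ y ∈ subtree R par v := by
  classical
  by_contra hc
  push Not at hc
  have hs := p.take_spec h
  have h1 := (F.mem_edges_iff hv _ (hp.takeUntil h)).2
    (by have := self_mem_subtree (R := R) (par := par) (v := v); tauto)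
  have h2 := (F.mem_edges_iff hv _ (hp.dropUntil h)).2
    (by have := self_mem_subtree (R := R) (par := par) (v := v); tauto)
  have hn := hp.edges_nodup
  rw [← hs, Walk.edges_append] at hn
  exact (List.nodup_append.1 hn).2.2 _ h1 _ h2 rfl

theorem mem_support_of_leaves (F : TriangleForest G R par dep) (p : G.Walk x y)
    (hx : x ∈ subtree R par v) (hy : y ∉ subtree R par v) : v ∈ p.support := by
  obtain ⟨d, hd, h1, h2⟩ := p.exists_boundary_dart _ hx hy
  obtain ⟨h3, -⟩ := F.eq_of_adj d.adj h1 h2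
  exact h3 ▸ p.dart_fst_mem_support_of_mem_darts hd

end TriangleForest

/-! ### Inner vertices -/

theorem mem_innerVertices {G : SimpleGraph V} {x y z : V} (p : G.Walk x y) (h : z ∈ p.support)
    (hx : z ≠ x) (hy : z ≠ y) : z ∈ innerVertices p := by
  unfold innerVertices
  rw [← p.cons_tail_support] at h
  have h1 : z ∈ p.support.tail := (List.mem_cons.1 h).resolve_left hx
  have hne : p.support.tail ≠ [] := List.ne_nil_of_mem h1
  have hl : p.support.tail.getLast hne = y := by
    rw [List.getLast_tail, Walk.getLast_support]
  rw [← List.dropLast_append_getLast hne, List.mem_append, hl] at h1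
  rcases h1 with h1 | h1
  · exact h1
  · simp at h1
    exact absurd h1 hy

theorem of_mem_innerVertices {G : SimpleGraph V} {x y z : V} {p : G.Walk x y} (hp : p.IsPath)
    (h : z ∈ innerVertices p) : z ∈ p.support ∧ z ≠ x ∧ z ≠ y := by
  unfold innerVertices at h
  have h1 := List.mem_of_mem_dropLast h
  have hne : p.support.tail ≠ [] := List.ne_nil_of_mem h1
  have hl : p.support.tail.getLast hne = y := by
    rw [List.getLast_tail, Walk.getLast_support]
  have hn := hp.support_nodup
  rw [← p.cons_tail_support] at hn ⊢
  refine ⟨List.mem_cons_of_mem _ h1, ?_, ?_⟩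
  · rintro rfl
    exact (List.nodup_cons.1 hn).1 h1
  · rintro rfl
    have hn2 := (List.nodup_cons.1 hn).2
    rw [← List.dropLast_append_getLast hne, hl] at hn2
    exact (List.nodup_append.1 hn2).2.2 _ h _ (List.mem_singleton_self _) rfl

theorem nodup_innerVertices {G : SimpleGraph V} {x y : V} {p : G.Walk x y} (hp : p.IsPath) :
    (innerVertices p).Nodup :=
  (hp.support_nodup.sublist (List.tail_sublist _)).sublist (List.dropLast_sublist _)

/-! ### Total-rainbow paths in terms of a single coloring of vertices and edges -/

/-- The inner vertices and the edges of a walk. -/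
def walkElements {G : SimpleGraph V} {x y : V} (p : G.Walk x y) : Set (V ⊕ Sym2 V) :=
  {z | Sum.elim (· ∈ innerVertices p) (· ∈ p.edges) z}

/-- The edges and inner vertices of a path are already distinct, so distinctness of the list of
their colors is injectivity of one joint coloring on a set. All later arguments use this form. -/
theorem isTotalRainbowPath_iff {G : SimpleGraph V} {C : Type*} {cv : V → C} {ce : Sym2 V → C}
    {x y : V} {p : G.Walk x y} : IsTotalRainbowPath cv ce p ↔
      p.IsPath ∧ Set.InjOn (Sum.elim cv ce) (walkElements p) := by
  have key : p.edges.map ce ++ (innerVertices p).map cv =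
      (p.edges.map Sum.inr ++ (innerVertices p).map Sum.inl).map (Sum.elim cv ce) := by
    simp [Function.comp_def]
  have hmem : ∀ z, z ∈ (p.edges.map Sum.inr ++ (innerVertices p).map Sum.inl) ↔
      z ∈ walkElements p := by
    rintro (z | z) <;> simp [walkElements]
  unfold IsTotalRainbowPath
  rw [key]
  refine and_congr_right fun hp => ?_
  constructor
  · intro h a ha b hb hab
    exact List.inj_on_of_nodup_map h ((hmem a).2 ha) ((hmem b).2 hb) hab
  · intro h
    refine List.Nodup.map_on (fun a ha b hb hab => h ((hmem a).1 ha) ((hmem b).1 hb) hab) ?_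
    refine List.nodup_append.2 ⟨?_, ?_, ?_⟩
    · exact hp.isTrail.edges_nodup.map Sum.inr_injective
    · exact (nodup_innerVertices hp).map Sum.inl_injective
    · intro a ha b hb
      simp only [List.mem_map] at ha hb
      obtain ⟨_, _, rfl⟩ := ha
      obtain ⟨_, _, rfl⟩ := hb
      simp

/-! ### The structure of a unicyclic graph of circumference three -/

theorem exists_triangle {G : SimpleGraph V} (huni : IsUnicyclic G) (hcirc : circumference G = 3) :
    ∃ a b c : V, G.Adj a b ∧ G.Adj b c ∧ G.Adj c a ∧
      ∀ s, IsCycleEdgeSet G s → s = {s(a, b), s(b, c), s(c, a)} := by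
  have hmem : (3 : ℕ) ∈ {k : ℕ | ∃ (u : V) (p : G.Walk u u), p.IsCycle ∧ p.length = k} := by
    rw [← hcirc]
    -- In `ℕ` the supremum of an empty or unbounded set is `0`, so the value `3` must be attained.
    refine Nat.sSup_mem ?_ ?_
    · by_contra h
      rw [Set.not_nonempty_iff_eq_empty] at h
      simp [circumference, h] at hcirc
    · by_contra h
      have := Nat.sSup_of_not_bddAbove h
      rw [circumference, this] at hcirc
      omega
  obtain ⟨u, p, hp, hl⟩ := hmem
  obtain ⟨s₀, -, hs₀⟩ := huni
  have h1 : {e | e ∈ p.edges} = s₀ := hs₀ _ ⟨u, p, hp, rfl⟩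
  match p, hl, h1 with
  | .cons (v := b) h₁ (.cons (v := c) h₂ (.cons h₃ .nil)), _, h1 =>
    refine ⟨u, b, c, h₁, h₂, h₃, fun s hs => ?_⟩
    rw [hs₀ s hs, ← h1]
    ext e
    simp

/-- Depth is the distance to the triangle, and a parent is any neighbor one step closer. If `xy`
were an edge of neither kind, all vertices would stay connected to `a` without it; so `xy` would lie
on a cycle, which by uniqueness is the triangle itself. -/
theorem exists_triangleForest {G : SimpleGraph V} (hconn : G.Connected)
    (huni : IsUnicyclic G) (hcirc : circumference G = 3) :
    ∃ (R : Finset V) (par : V → V) (dep : V → ℕ), TriangleForest G R par dep := by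
  classical
  obtain ⟨a, b, c, hab, hbc, hca, huniq⟩ := exists_triangle huni hcirc
  set R : Finset V := {a, b, c} with hR
  have hRne : R.Nonempty := ⟨a, by simp [hR]⟩
  have hroots : ∀ x ∈ R, ∀ y ∈ R, x ≠ y → G.Adj x y := by
    intro x hx y hy hxy
    simp only [hR, Finset.mem_insert, Finset.mem_singleton] at hx hy
    rcases hx with rfl | rfl | rfl <;> rcases hy with rfl | rfl | rfl <;>
      first
        | exact absurd rfl hxy
        | assumption
        | (apply Adj.symm; assumption)
  let dep : V → ℕ := fun v => R.inf' hRne (fun r => G.dist v r)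
  have dep_le : ∀ v, ∀ r ∈ R, dep v ≤ G.dist v r := fun v r hr => Finset.inf'_le _ hr
  have dep_eq : ∀ v, ∃ r ∈ R, dep v = G.dist v r := fun v => Finset.exists_mem_eq_inf' hRne _
  have hstep : ∀ v, v ∉ R → ∃ w, G.Adj v w ∧ dep v = dep w + 1 := by
    intro v hv
    obtain ⟨r, hr, h⟩ := dep_eq v
    obtain ⟨p, hp⟩ := hconn.exists_walk_length_eq_dist v r
    match p with
    | .nil => exact absurd hr hv
    | .cons (v := w) h1 q =>
      refine ⟨w, h1, ?_⟩
      have h2 := dep_le w r hr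
      have h3 := dist_le q
      rw [Walk.length_cons] at hp
      obtain ⟨r', hr', h'⟩ := dep_eq w
      have h4 := dep_le v r' hr'
      obtain ⟨q', hq'⟩ := hconn.exists_walk_length_eq_dist w r'
      have h5 := dist_le (Walk.cons h1 q')
      rw [Walk.length_cons] at h5
      omega
  have hpar : ∃ par : V → V, ∀ v, v ∉ R → G.Adj v (par v) ∧ dep v = dep (par v) + 1 := by
    refine ⟨fun v => if h : v ∉ R then (hstep v h).choose else v, fun v hv => ?_⟩
    simp only [hv, not_false_eq_true, dite_true]
    exact (hstep v hv).choose_spec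
  obtain ⟨par, hpar⟩ := hpar
  refine ⟨R, par, dep, ⟨?_, ?_, ?_, fun v hv => (hpar v hv).2⟩⟩
  · exact Finset.card_eq_three.2 ⟨a, b, c, hab.ne, hca.ne.symm, hbc.ne, rfl⟩
  · intro x y
    constructor
    · intro h
      by_contra hc
      push Not at hc
      obtain ⟨c1, c2, c3⟩ := hc
      have hreach : ∀ v, (G \ fromEdgeSet {s(x, y)}).Reachable v a := by
        have hadj : ∀ v w, G.Adj v w → s(v, w) ≠ s(x, y) →
            (G \ fromEdgeSet {s(x, y)}).Adj v w := by
          intro v w h1 h2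
          simp [h1, h2]
        intro v
        induction h : dep v using Nat.strong_induction_on generalizing v with
        | _ k ih =>
          by_cases hv : v ∈ R
          · by_cases hva : v = a
            · rw [hva]
            · refine (hadj v a (hroots _ hv _ (by simp [hR]) hva) ?_).reachable
              intro he
              have haR : a ∈ R := by simp [hR]
              rcases Sym2.eq_iff.1 he with ⟨rfl, rfl⟩ | ⟨rfl, rfl⟩
              · exact c1 hva hv haR
              · exact c1 (Ne.symm hva) haR hv
          · obtain ⟨h1, h2⟩ := hpar v hv
            refine (hadj v (par v) h1 ?_).reachable.trans (ih _ (by omega) _ rfl)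
            intro he
            rcases Sym2.eq_iff.1 he with ⟨rfl, rfl⟩ | ⟨rfl, rfl⟩
            · exact c3 hv rfl
            · exact c2 hv rfl
      obtain ⟨u, p, hp, he⟩ := adj_and_reachable_delete_edges_iff_exists_cycle.1
        ⟨h, (hreach x).trans (hreach y).symm⟩
      have h1 := huniq _ ⟨u, p, hp, rfl⟩
      have h2 : s(x, y) ∈ ({s(a, b), s(b, c), s(c, a)} : Set (Sym2 V)) := by
        rw [← h1]; exact he
      have h3 : x ∈ R ∧ y ∈ R := by
        simp only [Set.mem_insert_iff, Set.mem_singleton_iff, Sym2.eq_iff] at h2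
        rcases h2 with (⟨rfl, rfl⟩ | ⟨rfl, rfl⟩) | (⟨rfl, rfl⟩ | ⟨rfl, rfl⟩) |
          (⟨rfl, rfl⟩ | ⟨rfl, rfl⟩) <;> simp [hR]
      exact c1 h.ne h3.1 h3.2
    · rintro (⟨h1, h2, h3⟩ | ⟨h1, rfl⟩ | ⟨h1, rfl⟩)
      · exact hroots _ h2 _ h3 h1
      · exact (hpar _ h1).1.symm
      · exact (hpar _ h1).1
  · intro r hr
    have := dep_le r r hr
    simpa using this

/-- The vertices having a child. -/
def parents (R : Finset V) (par : V → V) : Set V := {v | ∃ w ∉ R, par w = v}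

/-! ### Cycles, hanging trees and leaves in terms of the parent function -/

namespace TriangleForest

variable {G : SimpleGraph V} {R : Finset V} {par : V → V} {dep : V → ℕ} {u v w x y : V}

theorem exists_third (F : TriangleForest G R par dep) (hu : u ∈ R) (hv : v ∈ R) (huv : u ≠ v) :
    ∃ w ∈ R, w ≠ u ∧ w ≠ v ∧ ∀ z ∈ R, z = u ∨ z = v ∨ z = w := by
  classical
  have h1 : ((R.erase u).erase v).card = 1 := by
    rw [Finset.card_erase_of_mem (Finset.mem_erase.2 ⟨huv.symm, hv⟩), Finset.card_erase_of_mem hu,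
      F.card_roots]
  obtain ⟨w, hw⟩ := Finset.card_eq_one.1 h1
  have hmem : ∀ z, (z ≠ v ∧ z ≠ u ∧ z ∈ R) ↔ z = w := by
    intro z
    have := Finset.ext_iff.1 hw z
    simpa using this
  obtain ⟨h2, h3, h4⟩ := (hmem w).2 rfl
  refine ⟨w, h4, h3, h2, fun z hz => ?_⟩
  by_contra hc
  push Not at hc
  exact hc.2.2 ((hmem z).1 ⟨hc.2.1, hc.1, hz⟩)

theorem exists_others (F : TriangleForest G R par dep) (hu : u ∈ R) :
    ∃ v ∈ R, ∃ w ∈ R, u ≠ v ∧ u ≠ w ∧ v ≠ w ∧ ∀ z ∈ R, z = u ∨ z = v ∨ z = w := by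
  obtain ⟨v, hv, hne⟩ := Finset.exists_mem_ne (s := R) (by rw [F.card_roots]; omega) u
  obtain ⟨w, hw, h1, h2, h3⟩ := F.exists_third hu hv hne.symm
  exact ⟨v, hv, w, hw, hne.symm, h1.symm, h2.symm, h3⟩

theorem exists_isCycle (F : TriangleForest G R par dep) (hu : u ∈ R) (hv : v ∈ R) (huv : u ≠ v) :
    ∃ p : G.Walk u u, p.IsCycle ∧ s(u, v) ∈ p.edges := by
  obtain ⟨w, hw, h1, h2, -⟩ := F.exists_third hu hv huv
  refine ⟨.cons (F.adj_roots hu hv huv) (.cons (F.adj_roots hv hw h2.symm)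
    (.cons (F.adj_roots hw hu h1) .nil)), ?_, by simp⟩
  rw [Walk.cons_isCycle_iff]
  simp [Walk.isPath_def, huv, huv.symm, h1, h1.symm, h2.symm]

/-- A closed trail has equal ends, which no bridge separates. -/
theorem edge_notMem_cycle (F : TriangleForest G R par dep) (hv : v ∉ R) {p : G.Walk x x}
    (hp : p.IsCycle) : s(v, par v) ∉ p.edges := by
  rw [F.mem_edges_iff hv p hp.isTrail]
  simp

theorem mem_cycleEdges (F : TriangleForest G R par dep) :
    s(x, y) ∈ cycleEdges G ↔ x ≠ y ∧ x ∈ R ∧ y ∈ R := by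
  constructor
  · rintro ⟨u, p, hp, he⟩
    rcases (F.adj_iff _ _).1 (p.adj_of_mem_edges he) with h | ⟨h1, rfl⟩ | ⟨h1, rfl⟩
    · exact h
    · exact absurd (Sym2.eq_swap ▸ he) (F.edge_notMem_cycle h1 hp)
    · exact absurd he (F.edge_notMem_cycle h1 hp)
  · rintro ⟨h1, h2, h3⟩
    obtain ⟨p, hp, he⟩ := F.exists_isCycle h2 h3 h1
    exact ⟨x, p, hp, he⟩

theorem cycleVertices_eq (F : TriangleForest G R par dep) : cycleVertices G = R := by
  ext u
  constructor
  · rintro ⟨p, hp⟩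
    match p, hp with
    | .nil, hp => exact absurd hp Walk.not_isCycle_nil
    | .cons (v := w) h q, hp =>
      exact (F.mem_cycleEdges.1 ⟨u, _, hp, by simp [Walk.edges_cons]⟩ : u ≠ w ∧ _ ∧ _).2.1
  · intro hu
    obtain ⟨v, hv, hne⟩ := Finset.exists_mem_ne (s := R) (by rw [F.card_roots]; omega) u
    obtain ⟨p, hp, -⟩ := F.exists_isCycle (v := v) hu hv hne.symm
    exact ⟨p, hp⟩

theorem cycleDeleted_adj (F : TriangleForest G R par dep) :
    (cycleDeleted G).Adj x y ↔ (y ∉ R ∧ x = par y) ∨ (x ∉ R ∧ y = par x) := by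
  rw [cycleDeleted, deleteEdges_adj, F.mem_cycleEdges, F.adj_iff]
  constructor
  · tauto
  · rintro (⟨h, rfl⟩ | ⟨h, rfl⟩) <;> tauto

theorem mem_subtree_of_cycleDeleted_adj (F : TriangleForest G R par dep) (hu : u ∈ R)
    (h : (cycleDeleted G).Adj x y) (hx : x ∈ subtree R par u) : y ∈ subtree R par u := by
  rcases F.cycleDeleted_adj.1 h with ⟨h1, rfl⟩ | ⟨h1, rfl⟩
  · exact mem_subtree_of_par h1 hx
  · exact par_mem_subtree hx (fun e => h1 (e ▸ hu))

theorem cycleDeleted_reachable (F : TriangleForest G R par dep) (h : w ∈ subtree R par v) :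
    (cycleDeleted G).Reachable w v := by
  induction h using ReflTransGen.head_induction_on with
  | refl => rfl
  | head h _ ih =>
    exact ((F.cycleDeleted_adj.2 (Or.inr h)).reachable).trans ih

theorem hangingTree_eq (F : TriangleForest G R par dep) (hu : u ∈ R) :
    hangingTree G u = subtree R par u := by
  ext v
  constructor
  · rintro ⟨p⟩
    by_contra hv
    obtain ⟨d, -, h1, h2⟩ := p.exists_boundary_dart _ (self_mem_subtree (R := R) (par := par)) hv
    exact h2 (F.mem_subtree_of_cycleDeleted_adj hu d.adj h1)
  · intro h
    exact (F.cycleDeleted_reachable h).symm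

theorem exists_child (h : w ∈ subtree R par v) (hne : w ≠ v) : v ∈ parents R par := by
  revert hne
  induction h using ReflTransGen.head_induction_on with
  | refl => exact fun h => absurd rfl h
  | @head a c h _ ih =>
    intro hne
    by_cases hc : c = v
    · exact ⟨a, h.1, h.2.symm.trans hc⟩
    · exact ih hc

theorem nontrivialRoots_eq (F : TriangleForest G R par dep) :
    nontrivialRoots G = ↑R ∩ parents R par := by
  ext u
  simp only [nontrivialRoots, Set.mem_ofPred_eq, F.cycleVertices_eq, Set.mem_inter_iff]
  refine and_congr_right fun hu => ?_
  rw [F.hangingTree_eq hu]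
  constructor
  · rintro ⟨v, hv, w, hw, h⟩
    rcases eq_or_ne v u with rfl | hne
    · exact exists_child hw h.ne'
    · exact exists_child hv hne
  · rintro ⟨w, hw, rfl⟩
    exact ⟨_, self_mem_subtree, w, mem_subtree_par hw, F.cycleDeleted_adj.2 (Or.inl ⟨hw, rfl⟩)⟩

/-- A root has two neighbors in the triangle. A nonroot with a child has that child and its parent
as neighbors, and these differ in depth. -/
theorem mem_leaves (F : TriangleForest G R par dep) :
    v ∈ leaves G ↔ v ∉ R ∧ v ∉ parents R par := by
  constructor
  · rintro ⟨w, hw, huniq⟩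
    have hv : v ∉ R := by
      intro hv
      obtain ⟨a, ha, b, hb, h1, h2, h3, -⟩ := F.exists_others hv
      exact h3 ((huniq a (F.adj_roots hv ha h1)).trans (huniq b (F.adj_roots hv hb h2)).symm)
    refine ⟨hv, ?_⟩
    rintro ⟨x, hx, rfl⟩
    have h1 := huniq _ (F.adj_par hv)
    have h2 := huniq _ (F.adj_par hx).symm
    have e1 := F.dep_par _ hv
    have e2 := F.dep_par _ hx
    rw [h1, ← h2] at e1
    omega
  · rintro ⟨h1, h2⟩
    refine ⟨par v, F.adj_par h1, fun y hy => ?_⟩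
    rcases (F.adj_iff _ _).1 hy with h | h | h
    · exact absurd h.2.1 h1
    · exact absurd ⟨y, h.1, h.2.symm⟩ h2
    · exact h.2

theorem eq_of_mem_subtree_leaf (F : TriangleForest G R par dep) (hv : v ∈ leaves G)
    (h : w ∈ subtree R par v) : w = v :=
  by_contra fun hne => (F.mem_leaves.1 hv).2 (exists_child h hne)

theorem leaf_adj_iff (F : TriangleForest G R par dep) (hv : v ∈ leaves G) :
    G.Adj w v ↔ w = par v := by
  rw [F.adj_iff]
  obtain ⟨h1, h2⟩ := F.mem_leaves.1 hv
  constructor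
  · rintro (h | h | h)
    · exact absurd h.2.2 h1
    · exact h.2
    · exact absurd ⟨w, h.1, h.2.symm⟩ h2
  · rintro rfl
    exact Or.inr (Or.inl ⟨h1, rfl⟩)

/-- A deepest descendant has no child. The hypothesis excludes a trivial root, whose only descendant
is itself. -/
theorem exists_leaf [Finite V] (F : TriangleForest G R par dep)
    (hv : v ∉ R ∨ v ∈ parents R par) : ∃ x ∈ leaves G, x ∈ subtree R par v := by
  obtain ⟨x, hx, hmax⟩ := Set.exists_max_image (subtree R par v) dep (Set.toFinite _)
    ⟨v, self_mem_subtree⟩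
  have hleaf : x ∉ parents R par := by
    rintro ⟨w, hw, rfl⟩
    have := hmax w (mem_subtree_of_par hw hx)
    have := F.dep_par w hw
    omega
  refine ⟨x, F.mem_leaves.2 ⟨fun hxR => ?_, hleaf⟩, hx⟩
  have := eq_of_root_mem_subtree hx hxR
  subst this
  tauto

theorem subtree_eq_of_not_parent (h : v ∉ parents R par) (hw : w ∈ subtree R par v) : w = v :=
  by_contra fun hne => h (exists_child hw hne)

end TriangleForest

/-! ### Bridges and cut vertices: their number and their colors -/

/-- The bridges (represented by their lower ends) and the cut vertices. -/
def treeElements (R : Finset V) (par : V → V) : Set (V ⊕ V) :=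
  {e | Sum.elim (· ∈ parents R par) (· ∉ R) e}

/-- The vertex representing a bridge or a cut vertex. -/
def base : V ⊕ V → V := Sum.elim id id

/-- The actual vertex or edge represented by an element. -/
def toElement (par : V → V) : V ⊕ V → V ⊕ Sym2 V := Sum.map id (fun v => s(v, par v))

namespace TriangleForest

variable {G : SimpleGraph V} {R : Finset V} {par : V → V} {dep : V → ℕ} {u v w x y : V}

/-- The nonroots, one for each bridge, split into those with a child and the leaves; the roots with
a child are the nontrivial roots. The equation is additive to avoid truncated subtraction. -/
theorem ncard_treeElements [Fintype V] (F : TriangleForest G R par dep) :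
    (treeElements R par).ncard + 6 + (leaves G).ncard =
      2 * Fintype.card V + (nontrivialRoots G).ncard := by
  classical
  have h1 : treeElements R par = Sum.inl '' parents R par ∪ Sum.inr '' {v | v ∉ R} := by
    ext (v | v) <;> simp [treeElements]
  have h2 : (treeElements R par).ncard = (parents R par).ncard + {v | v ∉ R}.ncard := by
    rw [h1, Set.ncard_union_eq, Set.ncard_image_of_injective _ Sum.inl_injective,
      Set.ncard_image_of_injective _ Sum.inr_injective]
    rw [Set.disjoint_left]
    rintro _ ⟨a, -, rfl⟩ ⟨b, -, hb⟩
    exact absurd hb (by simp)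
  have h3 : {v | v ∉ R}.ncard + 3 = Fintype.card V := by
    have := Set.ncard_add_ncard_compl (R : Set V)
    rw [Set.ncard_coe_finset, F.card_roots, Nat.card_eq_fintype_card] at this
    have e : {v | v ∉ R} = (R : Set V)ᶜ := by ext; simp
    rw [e]
    omega
  have h4 : (parents R par \ ↑R).ncard + (nontrivialRoots G).ncard = (parents R par).ncard := by
    rw [F.nontrivialRoots_eq, Set.inter_comm, add_comm]
    exact Set.ncard_inter_add_ncard_sdiff_eq_ncard _ _
  have h5 : (parents R par \ ↑R).ncard + (leaves G).ncard = {v | v ∉ R}.ncard := by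
    rw [← Set.ncard_union_eq]
    · congr 1
      ext v
      simp only [Set.mem_union, Set.mem_sdiff, F.mem_leaves, Set.mem_ofPred_eq, Finset.mem_coe]
      tauto
    · rw [Set.disjoint_left]
      intro v hv hv'
      exact (F.mem_leaves.1 hv').2 hv.1
  omega

theorem exists_leaf_base [Finite V] (F : TriangleForest G R par dep) {e : V ⊕ V}
    (he : e ∈ treeElements R par) : ∃ x ∈ leaves G, x ∈ subtree R par (base e) := by
  rcases e with v | v
  · exact F.exists_leaf (Or.inr he)
  · exact F.exists_leaf (Or.inl he)

theorem toElement_injOn (F : TriangleForest G R par dep) :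
    Set.InjOn (toElement par) (treeElements R par) := by
  rintro (v | v) hv (w | w) hw h
  · simpa [toElement] using h
  · simp [toElement] at h
  · simp [toElement] at h
  · simp only [toElement, Sum.map_inr, Sum.inr.injEq] at h
    rw [F.edge_injective hv hw h]

/-- A path joining a leaf below an element to a vertex not below it contains the element. -/
theorem mem_walkElements (F : TriangleForest G R par dep) {e : V ⊕ V}
    (he : e ∈ treeElements R par) {p : G.Walk x y} (hp : p.IsPath) (hx : x ∈ leaves G)
    (h1 : x ∈ subtree R par (base e)) (h2 : y ∉ subtree R par (base e)) :
    toElement par e ∈ walkElements p := by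
  rcases e with v | v
  · refine mem_innerVertices p (F.mem_support_of_leaves p h1 h2) ?_ ?_
    · rintro rfl
      exact (F.mem_leaves.1 hx).2 he
    · rintro rfl
      exact h2 self_mem_subtree
  · refine (F.mem_edges_iff he p hp.isTrail).2 ?_
    have h1 : x ∈ subtree R par v := h1
    have h2 : y ∉ subtree R par v := h2
    tauto

theorem mem_walkElements' (F : TriangleForest G R par dep) {e : V ⊕ V}
    (he : e ∈ treeElements R par) {p : G.Walk x y} (hp : p.IsPath) (hy : y ∈ leaves G)
    (h1 : y ∈ subtree R par (base e)) (h2 : x ∉ subtree R par (base e)) :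
    toElement par e ∈ walkElements p := by
  rcases e with v | v
  · refine mem_innerVertices p ?_ ?_ ?_
    · have := F.mem_support_of_leaves p.reverse h1 h2
      simpa [base] using this
    · rintro rfl
      exact h2 self_mem_subtree
    · rintro rfl
      exact (F.mem_leaves.1 hy).2 he
  · refine (F.mem_edges_iff he p hp.isTrail).2 ?_
    have h1 : y ∈ subtree R par v := h1
    have h2 : x ∉ subtree R par v := h2
    tauto

theorem exists_root_notMem (F : TriangleForest G R par dep) (x v w : V)
    (hv : x ∈ subtree R par v) (hw : x ∈ subtree R par w) :
    ∃ r, r ∉ subtree R par v ∧ r ∉ subtree R par w := by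
  obtain ⟨s, hs, hxs⟩ := F.exists_root x
  obtain ⟨r, hr, hne⟩ := Finset.exists_mem_ne (s := R) (by rw [F.card_roots]; omega) s
  have key : ∀ v, x ∈ subtree R par v → r ∉ subtree R par v := by
    intro v hv hrv
    have := eq_of_root_mem_subtree hrv hr
    subst this
    exact hne (root_unique hr hs hv hxs)
  exact ⟨r, key v hv, key w hw⟩

/-- In a coloring that makes the graph total-rainbow connected, the bridges and the cut vertices
have pairwise distinct colors. -/
theorem color_injOn [Finite V] (F : TriangleForest G R par dep) {C : Type*} {cv : V → C}
    {ce : Sym2 V → C} (hc : IsTRCColoring G cv ce) :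
    Set.InjOn (fun e => Sum.elim cv ce (toElement par e)) (treeElements R par) := by
  intro e he f hf hef
  apply F.toElement_injOn he hf
  -- If some leaf lies below both elements, a path from it to a root outside both subtrees contains
  -- both. Otherwise a path between a leaf below one and a leaf below the other does.
  by_cases hcom : ∃ x ∈ leaves G, x ∈ subtree R par (base e) ∧ x ∈ subtree R par (base f)
  · obtain ⟨x, hx, h1, h2⟩ := hcom
    obtain ⟨r, h3, h4⟩ := F.exists_root_notMem x _ _ h1 h2
    obtain ⟨p, hp⟩ := hc x r (fun h => h3 (h ▸ h1))
    obtain ⟨hp, hinj⟩ := isTotalRainbowPath_iff.1 hp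
    exact hinj (F.mem_walkElements he hp hx h1 h3) (F.mem_walkElements hf hp hx h2 h4) hef
  · push Not at hcom
    obtain ⟨x, hx, h1⟩ := F.exists_leaf_base he
    obtain ⟨y, hy, h2⟩ := F.exists_leaf_base hf
    have h3 := hcom x hx h1
    have h4 : y ∉ subtree R par (base e) := fun h => hcom y hy h h2
    obtain ⟨p, hp⟩ := hc x y (fun h => h3 (h ▸ h2))
    obtain ⟨hp, hinj⟩ := isTotalRainbowPath_iff.1 hp
    exact hinj (F.mem_walkElements he hp hx h1 h4) (F.mem_walkElements' hf hp hy h2 h3) hef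

theorem ncard_le_of_coloring [Finite V] (F : TriangleForest G R par dep) {k : ℕ} {cv : V → Fin k}
    {ce : Sym2 V → Fin k} (hc : IsTRCColoring G cv ce) : (treeElements R par).ncard ≤ k := by
  have := Set.ncard_le_ncard_of_injOn (t := Set.univ) _ (fun _ _ => Set.mem_univ _)
    (F.color_injOn hc)
  simpa using this

/-- If as few colors as possible are used, every color occurs on a bridge or a cut vertex. -/
theorem exists_element_color [Finite V] (F : TriangleForest G R par dep) {k : ℕ} {cv : V → Fin k}
    {ce : Sym2 V → Fin k} (hc : IsTRCColoring G cv ce) (hk : k ≤ (treeElements R par).ncard)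
    (c : Fin k) : ∃ e ∈ treeElements R par, Sum.elim cv ce (toElement par e) = c := by
  have := Set.surj_on_of_inj_on_of_ncard_le (t := Set.univ)
    (fun e (_ : e ∈ treeElements R par) => Sum.elim cv ce (toElement par e))
    (fun _ _ => Set.mem_univ _) (fun e f he hf h => F.color_injOn hc he hf h) (by simpa using hk)
    (Set.toFinite _) c (Set.mem_univ _)
  obtain ⟨e, he, h⟩ := this
  exact ⟨e, he, h.symm⟩

/-! ### Consequences of repeating colors on the triangle -/

/-- The engine of the lower bounds: a rainbow path through an element avoids any triangle edge of
the same color, since a triangle edge is never itself an element. -/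
theorem edge_notMem_of_color {C : Type*} {cv : V → C}
    {ce : Sym2 V → C} {p : G.Walk x y} {r s : V} (hr : r ∈ R) (hs : s ∈ R)
    (hinj : Set.InjOn (Sum.elim cv ce) (walkElements p)) {e : V ⊕ V} (he : e ∈ treeElements R par)
    (hcol : Sum.elim cv ce (toElement par e) = ce s(r, s)) (hmem : toElement par e ∈ walkElements p) :
    s(r, s) ∉ p.edges := by
  intro h
  have h1 := hinj hmem (show Sum.inr s(r, s) ∈ walkElements p from h) hcol
  rcases e with v | v
  · simp [toElement] at h1
  · simp only [toElement, Sum.map_inr, Sum.inr.injEq] at h1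
    exact edge_ne he hr hs h1

/-- A walk from one tree to another uses the edge between their roots, or passes through the
third root. -/
theorem direct_or_indirect (F : TriangleForest G R par dep) {a b c : V} (ha : a ∈ R) (hb : b ∈ R)
    (hR : ∀ z ∈ R, z = a ∨ z = b ∨ z = c) (hx : x ∈ subtree R par a)
    (hy : y ∈ subtree R par b) (hab : a ≠ b) (p : G.Walk x y) :
    s(a, b) ∈ p.edges ∨ (s(a, c) ∈ p.edges ∧ s(c, b) ∈ p.edges) := by
  have h1 : y ∉ subtree R par a := fun h => hab (root_unique ha hb h hy)
  have h2 : x ∉ subtree R par b := fun h => hab (root_unique ha hb hx h)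
  obtain ⟨d, hd, h3, h4⟩ := p.exists_boundary_dart _ hx h1
  obtain ⟨d', hd', h5, h6⟩ := p.reverse.exists_boundary_dart _ hy h2
  have e1 : s(d.fst, d.snd) ∈ p.edges := List.mem_map.2 ⟨d, hd, rfl⟩
  have e2 : s(d'.fst, d'.snd) ∈ p.edges := by
    have : s(d'.fst, d'.snd) ∈ p.reverse.edges := List.mem_map.2 ⟨d', hd', rfl⟩
    simpa using this
  obtain ⟨h7, h8 | h8⟩ := F.eq_of_adj d.adj h3 h4
  swap
  · exact absurd ha h8.1
  obtain ⟨h9, h10 | h10⟩ := F.eq_of_adj d'.adj h5 h6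
  swap
  · exact absurd hb h10.1
  rw [h7] at e1
  rw [h9] at e2
  have n1 : d.snd ≠ a := fun h => h4 (h ▸ self_mem_subtree)
  have n2 : d'.snd ≠ b := fun h => h6 (h ▸ self_mem_subtree)
  rcases hR _ h8.2 with h | h | h
  · exact absurd h n1
  · exact Or.inl (h ▸ e1)
  · rw [h] at e1
    rcases hR _ h10.2 with h | h | h
    · rw [h, Sym2.eq_swap] at e2
      exact Or.inl e2
    · exact absurd h n2
    · rw [h, Sym2.eq_swap] at e2
      exact Or.inr ⟨e1, e2⟩

/-- The elements lie in the tree of a parent root. -/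
theorem base_mem {e : V ⊕ V} (he : e ∈ treeElements R par)
    (hu : u ∈ R) (h : base e ∈ subtree R par u) : u ∈ parents R par := by
  rcases e with v | v
  · by_cases hv : v = u
    · exact hv ▸ he
    · exact exists_child h hv
  · exact exists_child h (fun hv => he ((show v = u from hv) ▸ hu))

/-- Necessary condition for the least conceivable number of colors: one nontrivial tree. -/
theorem exists_elements_of_one [Finite V] (F : TriangleForest G R par dep) {k : ℕ}
    {cv : V → Fin k} {ce : Sym2 V → Fin k} (hc : IsTRCColoring G cv ce)
    (hk : k ≤ (treeElements R par).ncard) (hu : nontrivialRoots G = {u}) :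
    ∃ c₂ ∈ treeElements R par, ∃ c₃ ∈ treeElements R par, ∃ d ∈ treeElements R par,
    ∃ a₃ ∈ treeElements R par, ∃ a₂ ∈ treeElements R par,
      (∀ x ∈ leaves G, x ∈ subtree R par (base c₂) → x ∉ subtree R par (base c₃) ∧
        x ∉ subtree R par (base d) ∧ x ∉ subtree R par (base a₃) ∧ a₃ ≠ c₃ ∧ a₃ ≠ d) ∧
      (∀ x ∈ leaves G, x ∈ subtree R par (base c₃) → x ∉ subtree R par (base c₂) ∧
        x ∉ subtree R par (base d) ∧ x ∉ subtree R par (base a₂) ∧ a₂ ≠ c₂ ∧ a₂ ≠ d) := by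
  rw [F.nontrivialRoots_eq] at hu
  have hu' : u ∈ (↑R ∩ parents R par : Set V) := hu ▸ rfl
  have htriv : ∀ v ∈ R, v ≠ u → v ∉ parents R par := fun v hv hne hp =>
    hne (show v ∈ ({u} : Set V) from hu ▸ ⟨hv, hp⟩)
  have huR : u ∈ R := hu'.1
  obtain ⟨q, hq, r, hr, huq, hur, hqr, hR⟩ := F.exists_others huR
  have hbase : ∀ e ∈ treeElements R par, base e ∈ subtree R par u := by
    intro e he
    obtain ⟨s, hs, h⟩ := F.exists_root (base e)
    by_cases hsu : s = u
    · exact hsu ▸ h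
    · exact absurd (base_mem he hs h) (htriv s hs hsu)
  have hleaf : ∀ x ∈ leaves G, x ∈ subtree R par u := by
    intro x hx
    obtain ⟨s, hs, h⟩ := F.exists_root x
    by_cases hsu : s = u
    · exact hsu ▸ h
    · have h1 := subtree_eq_of_not_parent (htriv s hs hsu) h
      exact absurd (h1 ▸ hs) (F.mem_leaves.1 hx).1
  -- One half of the claim, stated symmetrically in the trivial roots `q` and `r`. A path from `q`
  -- to a leaf below `c₂` cannot use `qu`, so it runs through `qr`, `r`, `ru`, and none of their
  -- colors may recur on it.
  have key : ∀ q ∈ R, ∀ r ∈ R, u ≠ q → u ≠ r → q ≠ r →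
      (∀ z ∈ R, z = q ∨ z = u ∨ z = r) → ∀ c₂ ∈ treeElements R par, ∀ c₃ ∈ treeElements R par,
      ∀ d ∈ treeElements R par, ∀ a ∈ treeElements R par,
      Sum.elim cv ce (toElement par c₂) = ce s(q, u) →
      Sum.elim cv ce (toElement par c₃) = ce s(r, u) →
      Sum.elim cv ce (toElement par d) = ce s(q, r) →
      Sum.elim cv ce (toElement par a) = cv r →
      (∀ x ∈ leaves G, x ∈ subtree R par (base c₂) → x ∉ subtree R par (base c₃) ∧
        x ∉ subtree R par (base d) ∧ x ∉ subtree R par (base a) ∧ a ≠ c₃ ∧ a ≠ d) := by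
    intro q hq r hr huq hur hqr hR c₂ hc₂ c₃ hc₃ d hd a ha e₂ e₃ ed ea x hx hx2
    have hxu := hleaf x hx
    have hqn : ∀ e ∈ treeElements R par, q ∉ subtree R par (base e) := by
      intro e he hqe
      exact huq (root_unique huR hq (hbase e he)
        (eq_of_root_mem_subtree hqe hq ▸ self_mem_subtree))
    have hqx : q ≠ x := fun h => (F.mem_leaves.1 hx).1 (h ▸ hq)
    have hrx : r ≠ x := fun h => (F.mem_leaves.1 hx).1 (h ▸ hr)
    obtain ⟨p, hp⟩ := hc q x hqx
    obtain ⟨hp, hinj⟩ := isTotalRainbowPath_iff.1 hp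
    have hon : ∀ e ∈ treeElements R par, x ∈ subtree R par (base e) →
        toElement par e ∈ walkElements p := fun e he hxe =>
      F.mem_walkElements' he hp hx hxe (hqn e he)
    have h1 := (F.direct_or_indirect hq huR hR self_mem_subtree hxu huq.symm p).resolve_left
      (edge_notMem_of_color hq huR hinj hc₂ e₂ (hon _ hc₂ hx2))
    have hri : Sum.inl r ∈ walkElements p :=
      mem_innerVertices p (p.fst_mem_support_of_mem_edges h1.2) hqr.symm hrx
    refine ⟨fun h => ?_, fun h => ?_, fun h => ?_, ?_, ?_⟩
    · exact edge_notMem_of_color hr huR hinj hc₃ e₃ (hon _ hc₃ h) h1.2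
    · exact edge_notMem_of_color hq hr hinj hd ed (hon _ hd h) h1.1
    · have h2 := hinj (hon _ ha h) hri ea
      rcases a with v | v
      · simp only [toElement, Sum.map_inl, id_eq, Sum.inl.injEq] at h2
        subst h2
        exact htriv v hr hur.symm ha
      · simp [toElement] at h2
    · rintro rfl
      have h2 := hinj hri (show Sum.inr s(r, u) ∈ walkElements p from h1.2) (ea.symm.trans e₃)
      simp at h2
    · rintro rfl
      have h2 := hinj hri (show Sum.inr s(q, r) ∈ walkElements p from h1.1) (ea.symm.trans ed)
      simp at h2
  -- The five elements repeat the colors of the three triangle edges and of the two trivial roots.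
  obtain ⟨c₂, hc₂, e₂⟩ := F.exists_element_color hc hk (ce s(q, u))
  obtain ⟨c₃, hc₃, e₃⟩ := F.exists_element_color hc hk (ce s(r, u))
  obtain ⟨d, hd, ed⟩ := F.exists_element_color hc hk (ce s(q, r))
  obtain ⟨a₃, ha₃, ea₃⟩ := F.exists_element_color hc hk (cv r)
  obtain ⟨a₂, ha₂, ea₂⟩ := F.exists_element_color hc hk (cv q)
  refine ⟨c₂, hc₂, c₃, hc₃, d, hd, a₃, ha₃, a₂, ha₂, ?_, ?_⟩
  · exact key q hq r hr huq hur hqr (fun z hz => by have := hR z hz; tauto) c₂ hc₂ c₃ hc₃ d hd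
      a₃ ha₃ e₂ e₃ ed ea₃
  · exact key r hr q hq hur huq hqr.symm (fun z hz => by have := hR z hz; tauto) c₃ hc₃ c₂ hc₂ d hd
      a₂ ha₂ e₃ e₂ (by rw [ed, Sym2.eq_swap]) ea₂

/-- Necessary condition for the least conceivable number of colors: two nontrivial trees. -/
theorem exists_elements_of_two [Finite V] (F : TriangleForest G R par dep) {k : ℕ}
    {cv : V → Fin k} {ce : Sym2 V → Fin k} (hc : IsTRCColoring G cv ce)
    (hk : k ≤ (treeElements R par).ncard) (h2 : (nontrivialRoots G).ncard = 2) :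
    ∃ u ∈ nontrivialRoots G, ∃ c ∈ treeElements R par, ∃ c' ∈ treeElements R par,
    ∃ d ∈ treeElements R par, ∃ a ∈ treeElements R par, a ≠ c' ∧ a ≠ d ∧
      (∀ e, e = c ∨ e = c' ∨ e = d ∨ e = a →
        ∀ x ∈ leaves G, x ∈ subtree R par (base e) → x ∈ subtree R par u) ∧
      (∀ x ∈ leaves G, x ∈ subtree R par (base c) → x ∉ subtree R par (base c') ∧
        x ∉ subtree R par (base d) ∧ x ∉ subtree R par (base a)) ∧
      (∀ x ∈ leaves G, x ∈ subtree R par (base c') → x ∉ subtree R par (base d)) := by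
  obtain ⟨u₁, u₂, hne, hu⟩ := Set.ncard_eq_two.1 h2
  rw [hu]
  rw [F.nontrivialRoots_eq] at hu
  have hu₁ : u₁ ∈ (↑R ∩ parents R par : Set V) := hu ▸ Or.inl rfl
  have hu₂ : u₂ ∈ (↑R ∩ parents R par : Set V) := hu ▸ Or.inr rfl
  obtain ⟨u₃, hu₃, h31, h32, hR⟩ := F.exists_third hu₁.1 hu₂.1 hne
  have htriv : u₃ ∉ parents R par := fun hp => by
    have : u₃ ∈ ({u₁, u₂} : Set V) := hu ▸ ⟨hu₃, hp⟩
    rcases this with h | h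
    · exact h31 h
    · exact h32 h
  -- Stated symmetrically in the two nontrivial roots: `u₁` is to be the root of the tree containing
  -- the element `c` colored like `u₁u₂`.
  have key : ∀ u₁ ∈ (↑R ∩ parents R par : Set V), ∀ u₂ ∈ (↑R ∩ parents R par : Set V), u₁ ≠ u₂ →
      u₃ ≠ u₁ → u₃ ≠ u₂ → (∀ z ∈ R, z = u₁ ∨ z = u₂ ∨ z = u₃) →
      ∀ c ∈ treeElements R par, ∀ c' ∈ treeElements R par,
      ∀ d ∈ treeElements R par, ∀ a ∈ treeElements R par,
      Sum.elim cv ce (toElement par c) = ce s(u₁, u₂) →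
      Sum.elim cv ce (toElement par c') = ce s(u₁, u₃) →
      Sum.elim cv ce (toElement par d) = ce s(u₃, u₂) →
      Sum.elim cv ce (toElement par a) = cv u₃ →
      base c ∈ subtree R par u₁ →
      a ≠ c' ∧ a ≠ d ∧
      (∀ e, e = c ∨ e = c' ∨ e = d ∨ e = a →
        ∀ x ∈ leaves G, x ∈ subtree R par (base e) → x ∈ subtree R par u₁) ∧
      (∀ x ∈ leaves G, x ∈ subtree R par (base c) → x ∉ subtree R par (base c') ∧
        x ∉ subtree R par (base d) ∧ x ∉ subtree R par (base a)) ∧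
      (∀ x ∈ leaves G, x ∈ subtree R par (base c') → x ∉ subtree R par (base d)) := by
    intro u₁ hu₁ u₂ hu₂ hne h31 h32 hR c hc₀ c' hc' d hd a ha ec ec' ed ea hb
    have hbase : ∀ e ∈ treeElements R par, base e ∈ subtree R par u₁ ∨
        base e ∈ subtree R par u₂ := by
      intro e he
      obtain ⟨s, hs, h⟩ := F.exists_root (base e)
      rcases hR s hs with rfl | rfl | rfl
      · exact Or.inl h
      · exact Or.inr h
      · exact absurd (base_mem he hs h) htriv
    have hdisj : ∀ z, z ∈ subtree R par u₁ → z ∉ subtree R par u₂ := fun z h h' =>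
      hne (root_unique hu₁.1 hu₂.1 h h')
    -- the consequences of a leaf below `c` being joined to a leaf of the other tree
    have main : ∀ x ∈ leaves G, x ∈ subtree R par (base c) → ∀ y ∈ leaves G,
        y ∈ subtree R par u₂ → (a ≠ c' ∧ a ≠ d) ∧ ∀ e, e = c' ∨ e = d ∨ e = a →
          x ∉ subtree R par (base e) ∧ y ∉ subtree R par (base e) := by
      intro x hx hxc y hy hyu
      have hxu : x ∈ subtree R par u₁ := subtree_trans hxc hb
      have hxy : x ≠ y := fun h => hdisj x hxu (h ▸ hyu)
      obtain ⟨p, hp⟩ := hc x y hxy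
      obtain ⟨hp, hinj⟩ := isTotalRainbowPath_iff.1 hp
      have hon : ∀ e ∈ treeElements R par, x ∈ subtree R par (base e) ∨ y ∈ subtree R par (base e) →
          toElement par e ∈ walkElements p := by
        intro e he hxy
        have hnot : ¬ (x ∈ subtree R par (base e) ∧ y ∈ subtree R par (base e)) := by
          rintro ⟨h1, h2⟩
          rcases hbase e he with h | h
          · exact hdisj y (subtree_trans h2 h) hyu
          · exact hdisj x hxu (subtree_trans h1 h)
        rcases hxy with h | h
        · exact F.mem_walkElements he hp hx h (fun h' => hnot ⟨h, h'⟩)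
        · exact F.mem_walkElements' he hp hy h (fun h' => hnot ⟨h', h⟩)
      have h1 := (F.direct_or_indirect hu₁.1 hu₂.1 hR hxu hyu hne p).resolve_left
        (edge_notMem_of_color hu₁.1 hu₂.1 hinj hc₀ ec (hon _ hc₀ (Or.inl hxc)))
      have hri : Sum.inl u₃ ∈ walkElements p :=
        mem_innerVertices p (p.fst_mem_support_of_mem_edges h1.2)
          (fun h => (F.mem_leaves.1 hx).1 (h ▸ hu₃)) (fun h => (F.mem_leaves.1 hy).1 (h ▸ hu₃))
      refine ⟨⟨?_, ?_⟩, ?_⟩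
      · rintro rfl
        have h2 := hinj hri (show Sum.inr s(u₁, u₃) ∈ walkElements p from h1.1) (ea.symm.trans ec')
        simp at h2
      · rintro rfl
        have h2 := hinj hri (show Sum.inr s(u₃, u₂) ∈ walkElements p from h1.2) (ea.symm.trans ed)
        simp at h2
      · intro e he
        rw [← not_or]
        intro hxy
        rcases he with rfl | rfl | rfl
        · exact edge_notMem_of_color hu₁.1 hu₃ hinj hc' ec' (hon _ hc' hxy) h1.1
        · exact edge_notMem_of_color hu₃ hu₂.1 hinj hd ed (hon _ hd hxy) h1.2
        · have h2 := hinj (hon _ ha hxy) hri ea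
          rcases e with v | v
          · simp only [toElement, Sum.map_inl, id_eq, Sum.inl.injEq] at h2
            subst h2
            exact htriv ha
          · simp [toElement] at h2
    obtain ⟨x₀, hx₀, hxc₀⟩ := F.exists_leaf_base hc₀
    obtain ⟨y₀, hy₀, hyu₀⟩ := F.exists_leaf (Or.inr hu₂.2)
    -- Were one of these elements in the tree of `u₂`, a leaf below it could not be joined to the
    -- leaf `x₀` below `c`, because the forced detour through `u₃` repeats its color.
    have hbase' : ∀ e, e = c' ∨ e = d ∨ e = a → base e ∈ subtree R par u₁ := by
      intro e he
      have heT : e ∈ treeElements R par := by rcases he with rfl | rfl | rfl <;> assumption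
      refine (hbase e heT).resolve_right fun h => ?_
      obtain ⟨y, hy, hye⟩ := F.exists_leaf_base heT
      exact ((main x₀ hx₀ hxc₀ y hy (subtree_trans hye h)).2 e he).2 hye
    refine ⟨(main x₀ hx₀ hxc₀ y₀ hy₀ hyu₀).1.1, (main x₀ hx₀ hxc₀ y₀ hy₀ hyu₀).1.2, ?_, ?_, ?_⟩
    · intro e he x _ hxe
      rcases he with rfl | he
      · exact subtree_trans hxe hb
      · exact subtree_trans hxe (hbase' e he)
    · intro x hx hxc
      have h := (main x hx hxc y₀ hy₀ hyu₀).2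
      exact ⟨(h c' (by tauto)).1, (h d (by tauto)).1, (h a (by tauto)).1⟩
    -- A path from `u₃` to a leaf below both `c'` and `d` could leave `u₃` by neither triangle edge.
    · intro x hx hxc' hxd
      have hxu := subtree_trans hxc' (hbase' c' (Or.inl rfl))
      have hux : u₃ ≠ x := fun h => (F.mem_leaves.1 hx).1 (h ▸ hu₃)
      obtain ⟨p, hp⟩ := hc u₃ x hux
      obtain ⟨hp, hinj⟩ := isTotalRainbowPath_iff.1 hp
      have hon : ∀ e, base e ∈ subtree R par u₁ → e ∈ treeElements R par →
          x ∈ subtree R par (base e) → toElement par e ∈ walkElements p := fun e h he hxe =>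
        F.mem_walkElements' he hp hx hxe (fun h' => h31
          (eq_of_root_mem_subtree (subtree_trans h' h) hu₃))
      have hd2 := edge_notMem_of_color hu₃ hu₂.1 hinj hd ed
        (hon d (hbase' d (by tauto)) hd hxd)
      have hd1 := edge_notMem_of_color hu₁.1 hu₃ hinj hc' ec'
        (hon c' (hbase' c' (by tauto)) hc' hxc')
      rcases F.direct_or_indirect hu₃ hu₁.1 (c := u₂) (fun z hz => by have := hR z hz; tauto)
        self_mem_subtree hxu h31 p with h | h
      · exact hd1 (Sym2.eq_swap ▸ h)
      · exact hd2 h.1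
  obtain ⟨c, hc₀, ec⟩ := F.exists_element_color hc hk (ce s(u₁, u₂))
  obtain ⟨c', hc', ec'⟩ := F.exists_element_color hc hk (ce s(u₁, u₃))
  obtain ⟨d, hd, ed⟩ := F.exists_element_color hc hk (ce s(u₃, u₂))
  obtain ⟨a, ha, ea⟩ := F.exists_element_color hc hk (cv u₃)
  obtain ⟨s, hs, h⟩ := F.exists_root (base c)
  rcases hR s hs with rfl | rfl | rfl
  · exact ⟨s, Or.inl rfl, c, hc₀, c', hc', d, hd, a, ha,
      key s hu₁ u₂ hu₂ hne h31 h32 hR c hc₀ c' hc' d hd a ha ec ec' ed ea h⟩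
  -- When `c` lies in the other tree the two roots swap roles, which exchanges `c'` and `d`.
  · exact ⟨s, Or.inr rfl, c, hc₀, d, hd, c', hc', a, ha,
      key s hu₂ u₁ hu₁ hne.symm h32 h31 (fun z hz => by have := hR z hz; tauto) c hc₀ d hd c' hc'
        a ha (by rw [ec, Sym2.eq_swap]) (by rw [ed, Sym2.eq_swap]) (by rw [ec', Sym2.eq_swap]) ea h⟩
  · exact absurd (base_mem hc₀ hs h) htriv

end TriangleForest

/-! ### Colorings with values in an arbitrary finite set -/

theorem trc_le_of_coloring {G : SimpleGraph V} {C : Type*} {cv : V → C} {ce : Sym2 V → C}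
    (hc : IsTRCColoring G cv ce) (K : Set C) (hK : K.Finite) (hv : ∀ v, cv v ∈ K)
    (he : ∀ e, ce e ∈ K) : trc G ≤ K.ncard := by
  have := hK.to_subtype
  let f : K ≃ Fin K.ncard := Finite.equivFin K
  refine Nat.sInf_le ⟨fun v => f ⟨cv v, hv v⟩, fun e => f ⟨ce e, he e⟩, fun x y hxy => ?_⟩
  obtain ⟨p, hp⟩ := hc x y hxy
  obtain ⟨hp, hinj⟩ := isTotalRainbowPath_iff.1 hp
  refine ⟨p, isTotalRainbowPath_iff.2 ⟨hp, fun a ha b hb hab => hinj ha hb ?_⟩⟩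
  rcases a with a | a <;> rcases b with b | b <;> simpa using hab

theorem exists_coloring_trc [Finite V] {G : SimpleGraph V} (hconn : G.Connected) :
    ∃ (cv : V → Fin (trc G)) (ce : Sym2 V → Fin (trc G)), IsTRCColoring G cv ce := by
  classical
  refine Nat.sInf_mem (s := {k : ℕ | ∃ (cv : V → Fin k) (ce : Sym2 V → Fin k),
    IsTRCColoring G cv ce}) ⟨Nat.card (V ⊕ Sym2 V),
      fun v => Finite.equivFin (V ⊕ Sym2 V) (Sum.inl v),
      fun e => Finite.equivFin (V ⊕ Sym2 V) (Sum.inr e), fun x y _ => ?_⟩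
  obtain ⟨p⟩ := hconn x y
  refine ⟨p.bypass, isTotalRainbowPath_iff.2 ⟨p.bypass_isPath, fun a _ b _ hab => ?_⟩⟩
  apply (Finite.equivFin (V ⊕ Sym2 V)).injective
  rcases a with a | a <;> rcases b with b | b <;> exact hab

theorem IsTotalRainbowPath.reverse {G : SimpleGraph V} {C : Type*} {cv : V → C} {ce : Sym2 V → C}
    {x y : V} {p : G.Walk x y} (h : IsTotalRainbowPath cv ce p) :
    IsTotalRainbowPath cv ce p.reverse := by
  obtain ⟨hp, hinj⟩ := isTotalRainbowPath_iff.1 h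
  refine isTotalRainbowPath_iff.2 ⟨hp.reverse, hinj.mono ?_⟩
  rintro (v | e) hz
  · obtain ⟨h1, h2, h3⟩ := of_mem_innerVertices hp.reverse hz
    exact mem_innerVertices p (by simpa using h1) h3 h2
  · exact (by simpa [walkElements] using hz : e ∈ p.edges)

/-! ### Colorings in which bridges and cut vertices keep their own colors -/

section Coloring

open scoped Classical in
/-- The coloring of the vertices giving every cut vertex its own color. -/
noncomputable def vertexColor (R : Finset V) (par : V → V) (κ : V → Option (V ⊕ V)) (v : V) :
    Option (V ⊕ V) :=
  if v ∈ parents R par then some (Sum.inl v) else κ v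

open scoped Classical in
/-- The coloring of the edges giving every bridge its own color. -/
noncomputable def edgeColor (R : Finset V) (par : V → V) (τ : Sym2 V → Option (V ⊕ V))
    (e : Sym2 V) : Option (V ⊕ V) :=
  if h : ∃ v, v ∉ R ∧ e = s(v, par v) then some (Sum.inr h.choose) else τ e

end Coloring

namespace TriangleForest

variable {G : SimpleGraph V} {R : Finset V} {par : V → V} {dep : V → ℕ} {u v w x y a b c : V}
  {κ : V → Option (V ⊕ V)} {τ : Sym2 V → Option (V ⊕ V)}

theorem edgeColor_tree (F : TriangleForest G R par dep) (hv : v ∉ R) :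
    edgeColor R par τ s(v, par v) = some (Sum.inr v) := by
  have h : ∃ w, w ∉ R ∧ s(v, par v) = s(w, par w) := ⟨v, hv, rfl⟩
  rw [edgeColor, dif_pos h, ← F.edge_injective hv h.choose_spec.1 h.choose_spec.2]

theorem edgeColor_root (ha : a ∈ R) (hb : b ∈ R) : edgeColor R par τ s(a, b) = τ s(a, b) := by
  rw [edgeColor, dif_neg]
  rintro ⟨v, hv, h⟩
  exact edge_ne hv ha hb h.symm

theorem color_toElement (F : TriangleForest G R par dep) {e : V ⊕ V}
    (he : e ∈ treeElements R par) :
    Sum.elim (vertexColor R par κ) (edgeColor R par τ) (toElement par e) = some e := by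
  rcases e with v | v
  · exact if_pos he
  · exact F.edgeColor_tree he

/-- Bridges and cut vertices have their own colors, so only the set `Z` of the other edges and inner
vertices needs checking: within itself, and against the elements on the path. -/
theorem isTotalRainbowPath_of (F : TriangleForest G R par dep) {p : G.Walk x y} (hp : p.IsPath)
    (Z : Set (V ⊕ Sym2 V)) (hZe : ∀ e ∈ p.edges, (∃ v ∉ R, e = s(v, par v)) ∨ Sum.inr e ∈ Z)
    (hZv : ∀ v ∈ innerVertices p, v ∈ parents R par ∨ Sum.inl v ∈ Z)
    (hinj : Set.InjOn (Sum.elim (vertexColor R par κ) (edgeColor R par τ)) Z)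
    (hcol : ∀ z ∈ Z, ∀ e ∈ treeElements R par, toElement par e ∈ walkElements p →
      Sum.elim (vertexColor R par κ) (edgeColor R par τ) z ≠ some e) :
    IsTotalRainbowPath (vertexColor R par κ) (edgeColor R par τ) p := by
  refine isTotalRainbowPath_iff.2 ⟨hp, ?_⟩
  have hsplit : ∀ z ∈ walkElements p, (∃ e ∈ treeElements R par, z = toElement par e) ∨ z ∈ Z := by
    rintro (v | e) hz
    · exact (hZv v hz).imp (fun h => ⟨Sum.inl v, h, rfl⟩) id
    · refine (hZe e hz).imp ?_ id
      rintro ⟨v, hv, rfl⟩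
      exact ⟨Sum.inr v, hv, rfl⟩
  intro z hz z' hz' h
  rcases hsplit z hz with ⟨e, he, rfl⟩ | h1 <;> rcases hsplit z' hz' with ⟨e', he', rfl⟩ | h2
  · rw [F.color_toElement he, F.color_toElement he', Option.some.injEq] at h
    rw [h]
  · rw [F.color_toElement he] at h
    exact absurd h.symm (hcol z' h2 e he hz)
  · rw [F.color_toElement he'] at h
    exact absurd h (hcol z h1 e' he' hz')
  · exact hinj h1 h2 h

theorem exists_walk_up (F : TriangleForest G R par dep) (h : w ∈ subtree R par v) :
    ∃ p : G.Walk w v, (∀ e ∈ p.edges, ∃ z ∉ R, e = s(z, par z)) ∧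
      ∀ z ∈ p.support, z ∈ subtree R par v := by
  induction h using ReflTransGen.head_induction_on with
  | refl => exact ⟨.nil, by simp, by simpa using self_mem_subtree⟩
  | @head a c h h' ih =>
    obtain ⟨h1, rfl⟩ := h
    obtain ⟨p, hp1, hp2⟩ := ih
    refine ⟨.cons (F.adj_par h1) p, ?_, ?_⟩
    · intro e he
      rw [Walk.edges_cons, List.mem_cons] at he
      rcases he with rfl | he
      · exact ⟨a, h1, rfl⟩
      · exact hp1 e he
    · intro z hz
      rw [Walk.support_cons, List.mem_cons] at hz
      rcases hz with rfl | hz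
      · exact mem_subtree_of_par h1 h'
      · exact hp2 z hz

/-- Extend a walk between roots to a path between vertices of the corresponding trees. -/
theorem exists_path_via (F : TriangleForest G R par dep)
    (hx : x ∈ subtree R par a) (hy : y ∈ subtree R par b) (q : G.Walk a b) :
    ∃ p : G.Walk x y, p.IsPath ∧
      (∀ e ∈ p.edges, (∃ v ∉ R, e = s(v, par v)) ∨ e ∈ q.edges) ∧
      (∀ z ∈ innerVertices p, z ∈ R → z ∈ q.support) ∧
      (∀ z ∈ innerVertices p, z ∈ parents R par ∨ (z ∈ q.support ∧ z ≠ a ∧ z ≠ b)) := by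
  classical
  obtain ⟨p₁, h1, h2⟩ := F.exists_walk_up hx
  obtain ⟨p₂, h3, h4⟩ := F.exists_walk_up hy
  let W := p₁.append (q.append p₂.reverse)
  have hsupp : ∀ z ∈ W.bypass.support, z ∈ R → z ∈ q.support := by
    intro z hz hzR
    have := W.support_bypass_subset_support hz
    simp only [W, Walk.mem_support_append_iff, Walk.support_reverse, List.mem_reverse] at this
    rcases this with h | h | h
    · rw [eq_of_root_mem_subtree (h2 z h) hzR]
      exact q.start_mem_support
    · exact h
    · rw [eq_of_root_mem_subtree (h4 z h) hzR]
      exact q.end_mem_support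
  refine ⟨W.bypass, W.bypass_isPath, ?_, ?_, ?_⟩
  · intro e he
    have := W.edges_bypass_subset_edges he
    simp only [W, Walk.edges_append, Walk.edges_reverse, List.mem_append, List.mem_reverse] at this
    rcases this with h | h | h
    · exact Or.inl (h1 e h)
    · exact Or.inr h
    · exact Or.inl (h3 e h)
  · intro z hz
    exact hsupp z (of_mem_innerVertices W.bypass_isPath hz).1
  · intro z hz
    obtain ⟨h5, h6, h7⟩ := of_mem_innerVertices W.bypass_isPath hz
    by_cases hzR : z ∈ R
    · by_cases hza : z = a
      · exact Or.inl (hza ▸ exists_child hx (hza ▸ h6.symm))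
      · by_cases hzb : z = b
        · exact Or.inl (hzb ▸ exists_child hy (hzb ▸ h7.symm))
        · exact Or.inr ⟨hsupp z h5 hzR, hza, hzb⟩
    · left
      rcases F.mem_subtree_of_mem_support hzR _ W.bypass_isPath.isTrail h5 with h | h
      · exact exists_child h h6.symm
      · exact exists_child h h7.symm

theorem exists_rainbow_same (F : TriangleForest G R par dep)
    (hx : x ∈ subtree R par a) (hy : y ∈ subtree R par a) :
    ∃ p : G.Walk x y, IsTotalRainbowPath (vertexColor R par κ) (edgeColor R par τ) p := by
  obtain ⟨p, hp, h1, -, h3⟩ := F.exists_path_via hx hy .nil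
  refine ⟨p, F.isTotalRainbowPath_of hp ∅ ?_ ?_ ?_ ?_⟩
  · exact fun e he => Or.inl ((h1 e he).resolve_right (by simp))
  · exact fun z hz => Or.inl ((h3 z hz).resolve_right (by simp))
  · exact Set.injOn_empty _
  · simp

/-- Only the edge `ab` can cause a conflict. Its color is harmless if it belongs to the third root,
which the path avoids, or to a bridge with neither `x` nor `y` below it. -/
theorem exists_rainbow_direct (F : TriangleForest G R par dep) (ha : a ∈ R) (hb : b ∈ R)
    (hab : a ≠ b) (hx : x ∈ subtree R par a) (hy : y ∈ subtree R par b)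
    (hτ : ∀ e ∈ treeElements R par, τ s(a, b) = some e →
      (∃ c ∈ R, c ≠ a ∧ c ≠ b ∧ e = Sum.inl c) ∨
      (∃ t ∉ R, e = Sum.inr t ∧ x ∉ subtree R par t ∧ y ∉ subtree R par t)) :
    ∃ p : G.Walk x y, IsTotalRainbowPath (vertexColor R par κ) (edgeColor R par τ) p := by
  obtain ⟨p, hp, h1, h2, h3⟩ := F.exists_path_via hx hy (F.adj_roots ha hb hab).toWalk
  refine ⟨p, F.isTotalRainbowPath_of hp {Sum.inr s(a, b)} ?_ ?_ ?_ ?_⟩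
  · exact fun e he => (h1 e he).imp id (by simp)
  · refine fun z hz => Or.inl ((h3 z hz).resolve_right ?_)
    rintro ⟨h, h4, h5⟩
    simp at h
    tauto
  · exact Set.injOn_singleton _ _
  · rintro _ rfl e he hmem h
    rw [Sum.elim_inr, edgeColor_root ha hb] at h
    rcases hτ e he h with ⟨c, hc, hca, hcb, rfl⟩ | ⟨t, ht, rfl, hxt, hyt⟩
    · have := h2 c hmem hc
      simp at this
      tauto
    · have := (F.mem_edges_iff ht p hp.isTrail).1 hmem
      tauto

/-- The detour through `c` introduces two triangle edges. It introduces a third color to control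
only when `c` is not a cut vertex; this is the role of `hκ`. -/
theorem exists_rainbow_indirect (F : TriangleForest G R par dep) (ha : a ∈ R) (hb : b ∈ R)
    (hc : c ∈ R) (hac : a ≠ c) (hcb : c ≠ b) (hx : x ∈ subtree R par a)
    (hy : y ∈ subtree R par b) {t t' : V} (ht : t ∉ R) (ht' : t' ∉ R) (htt' : t ≠ t')
    (hτ : τ s(a, c) = some (Sum.inr t)) (hτ' : τ s(c, b) = some (Sum.inr t'))
    (hxt : x ∉ subtree R par t) (hyt : y ∉ subtree R par t)
    (hxt' : x ∉ subtree R par t') (hyt' : y ∉ subtree R par t')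
    (hκ : c ∉ parents R par → ∃ m ∉ R, κ c = some (Sum.inr m) ∧ m ≠ t ∧ m ≠ t' ∧
      x ∉ subtree R par m ∧ y ∉ subtree R par m) :
    ∃ p : G.Walk x y, IsTotalRainbowPath (vertexColor R par κ) (edgeColor R par τ) p := by
  obtain ⟨p, hp, h1, h2, h3⟩ := F.exists_path_via hx hy
    (.cons (F.adj_roots ha hc hac) (F.adj_roots hc hb hcb).toWalk)
  have e1 : Sum.elim (vertexColor R par κ) (edgeColor R par τ) (Sum.inr s(a, c)) =
      some (Sum.inr t) := by rw [Sum.elim_inr, edgeColor_root ha hc, hτ]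
  have e2 : Sum.elim (vertexColor R par κ) (edgeColor R par τ) (Sum.inr s(c, b)) =
      some (Sum.inr t') := by rw [Sum.elim_inr, edgeColor_root hc hb, hτ']
  have hnot : ∀ t ∉ R, x ∉ subtree R par t → y ∉ subtree R par t → ∀ e ∈ treeElements R par,
      toElement par e ∈ walkElements p → some (Sum.inr t) ≠ some e := by
    intro t ht hx hy e he hmem h
    obtain rfl := Option.some.inj h
    have := (F.mem_edges_iff ht p hp.isTrail).1 hmem
    tauto
  have hedges : ∀ e ∈ p.edges, (∃ v ∉ R, e = s(v, par v)) ∨ e = s(a, c) ∨ e = s(c, b) :=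
    fun e he => (h1 e he).imp id (by simp)
  have hinner : ∀ z ∈ innerVertices p, z ∈ parents R par ∨ z = c := by
    refine fun z hz => (h3 z hz).imp id ?_
    rintro ⟨h, h4, h5⟩
    simp at h
    tauto
  by_cases hcp : c ∈ parents R par
  · refine ⟨p, F.isTotalRainbowPath_of hp {Sum.inr s(a, c), Sum.inr s(c, b)} ?_ ?_ ?_ ?_⟩
    · exact fun e he => (hedges e he).imp id (by simp)
    · exact fun z hz => Or.inl ((hinner z hz).elim id (fun h => h ▸ hcp))
    · rintro _ (rfl | rfl) _ (rfl | rfl) h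
      · rfl
      · rw [e1, e2] at h
        simp [htt'] at h
      · rw [e1, e2] at h
        simp [htt'.symm] at h
      · rfl
    · rintro _ (rfl | rfl)
      · rw [e1]
        exact hnot t ht hxt hyt
      · rw [e2]
        exact hnot t' ht' hxt' hyt'
  · obtain ⟨m, hm, hκm, hmt, hmt', hxm, hym⟩ := hκ hcp
    have e3 : Sum.elim (vertexColor R par κ) (edgeColor R par τ) (Sum.inl c) =
        some (Sum.inr m) := by rw [Sum.elim_inl, vertexColor, if_neg hcp, hκm]
    refine ⟨p, F.isTotalRainbowPath_of hp {Sum.inr s(a, c), Sum.inr s(c, b), Sum.inl c} ?_ ?_ ?_ ?_⟩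
    · exact fun e he => (hedges e he).imp id (by simp)
    · exact fun z hz => (hinner z hz).imp id (by simp)
    · rintro _ (rfl | rfl | rfl) _ (rfl | rfl | rfl) h <;> first
        | rfl
        | (exfalso
           simp only [e1, e2, e3, Option.some.injEq, Sum.inr.injEq] at h
           first | exact htt' h | exact htt' h.symm | exact hmt h | exact hmt h.symm
                 | exact hmt' h | exact hmt' h.symm)
    · rintro _ (rfl | rfl | rfl)
      · rw [e1]
        exact hnot t ht hxt hyt
      · rw [e2]
        exact hnot t' ht' hxt' hyt'
      · rw [e3]
        exact hnot m hm hxm hym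

/-! ### The upper bounds -/

/-- It suffices to join vertices of different trees, in one of the two orders. -/
theorem isTRCColoring_of (F : TriangleForest G R par dep) {a b c : V}
    (hR : ∀ z ∈ R, z = a ∨ z = b ∨ z = c) (ha : a ∈ R) (hb : b ∈ R) (hc : c ∈ R)
    (hab : ∀ x ∈ subtree R par a, ∀ y ∈ subtree R par b, ∃ p : G.Walk x y,
      IsTotalRainbowPath (vertexColor R par κ) (edgeColor R par τ) p)
    (hac : ∀ x ∈ subtree R par a, ∀ y ∈ subtree R par c, ∃ p : G.Walk x y,
      IsTotalRainbowPath (vertexColor R par κ) (edgeColor R par τ) p)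
    (hbc : ∀ x ∈ subtree R par b, ∀ y ∈ subtree R par c, ∃ p : G.Walk x y,
      IsTotalRainbowPath (vertexColor R par κ) (edgeColor R par τ) p) :
    IsTRCColoring G (vertexColor R par κ) (edgeColor R par τ) := by
  have hrev : ∀ {x y : V}, (∃ p : G.Walk x y,
      IsTotalRainbowPath (vertexColor R par κ) (edgeColor R par τ) p) → ∃ p : G.Walk y x,
      IsTotalRainbowPath (vertexColor R par κ) (edgeColor R par τ) p :=
    fun ⟨p, hp⟩ => ⟨p.reverse, hp.reverse⟩
  intro x y _
  obtain ⟨r, hr, hx⟩ := F.exists_root x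
  obtain ⟨s, hs, hy⟩ := F.exists_root y
  rcases hR r hr with rfl | rfl | rfl <;> rcases hR s hs with rfl | rfl | rfl
  · exact F.exists_rainbow_same hx hy
  · exact hab x hx y hy
  · exact hac x hx y hy
  · exact hrev (hab y hy x hx)
  · exact F.exists_rainbow_same hx hy
  · exact hbc x hx y hy
  · exact hrev (hac y hy x hx)
  · exact hrev (hbc y hy x hx)
  · exact F.exists_rainbow_same hx hy

theorem trc_le_of_colors [Finite V] {K : Set (Option (V ⊕ V))}
    (hK : some '' treeElements R par ⊆ K) (hκ : ∀ v, κ v ∈ K) (hτ : ∀ e, τ e ∈ K)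
    (hc : IsTRCColoring G (vertexColor R par κ) (edgeColor R par τ)) : trc G ≤ K.ncard := by
  refine trc_le_of_coloring hc K (Set.toFinite _) (fun v => ?_) (fun e => ?_)
  · unfold vertexColor
    split_ifs with h
    · exact hK ⟨_, h, rfl⟩
    · exact hκ v
  · unfold edgeColor
    split_ifs with h
    · exact hK ⟨_, h.choose_spec.1, rfl⟩
    · exact hτ e

theorem trc_le_of_colors_treeElements [Finite V]
    (hκ : ∀ v, κ v ∈ some '' treeElements R par) (hτ : ∀ e, τ e ∈ some '' treeElements R par)
    (hc : IsTRCColoring G (vertexColor R par κ) (edgeColor R par τ)) :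
    trc G ≤ (treeElements R par).ncard := by
  have := trc_le_of_colors le_rfl hκ hτ hc
  rwa [Set.ncard_image_of_injective _ (Option.some_injective _)] at this

/-- The extra color is `none`, used on all triangle edges and all noncut vertices. Direct paths meet
it only once. -/
theorem trc_le_succ [Finite V] (F : TriangleForest G R par dep) :
    trc G ≤ (treeElements R par).ncard + 1 := by
  classical
  have hd : ∀ a ∈ R, ∀ b ∈ R, a ≠ b → ∀ x ∈ subtree R par a, ∀ y ∈ subtree R par b,
      ∃ p : G.Walk x y, IsTotalRainbowPath (vertexColor R par fun _ => none)
        (edgeColor R par fun _ => none) p := fun a ha b hb hab x hx y hy =>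
    F.exists_rainbow_direct ha hb hab hx hy (by simp)
  obtain ⟨a, b, c, hab, hac, hbc, hR⟩ := Finset.card_eq_three.1 F.card_roots
  have ha : a ∈ R := by simp [hR]
  have hb : b ∈ R := by simp [hR]
  have hc : c ∈ R := by simp [hR]
  have h := trc_le_of_colors (K := insert none (some '' treeElements R par))
    (Set.subset_insert _ _) (κ := fun _ => none) (τ := fun _ => none) (by simp) (by simp)
    (F.isTRCColoring_of (by simp [hR]) ha hb hc (hd a ha b hb hab) (hd a ha c hc hac)
      (hd b hb c hc hbc))
  refine h.trans ((Set.ncard_insert_le _ _).trans ?_)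
  rw [Set.ncard_image_of_injective _ (Option.some_injective _)]

/-- Each triangle edge takes the color of the opposite root, a cut vertex that the direct path
avoids. The value of `κ` is immaterial. -/
theorem trc_le_of_three [Finite V] (F : TriangleForest G R par dep)
    (h : ∀ r ∈ R, r ∈ parents R par) : trc G ≤ (treeElements R par).ncard := by
  classical
  obtain ⟨a, b, c, hab, hac, hbc, hR⟩ := Finset.card_eq_three.1 F.card_roots
  have ha : a ∈ R := by simp [hR]
  have hb : b ∈ R := by simp [hR]
  have hc : c ∈ R := by simp [hR]
  let τ : Sym2 V → Option (V ⊕ V) := fun e =>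
    if e = s(a, b) then some (Sum.inl c) else if e = s(a, c) then some (Sum.inl b)
    else some (Sum.inl a)
  have h1 : τ s(a, b) = some (Sum.inl c) := by simp [τ]
  have h2 : τ s(a, c) = some (Sum.inl b) := by simp [τ, hab, hbc.symm]
  have h3 : τ s(b, c) = some (Sum.inl a) := by simp [τ, hab.symm, hbc]
  have hd : ∀ κ : V → Option (V ⊕ V), ∀ a ∈ R, ∀ b ∈ R, ∀ c ∈ R, a ≠ b → c ≠ a → c ≠ b →
      τ s(a, b) = some (Sum.inl c) → ∀ x ∈ subtree R par a, ∀ y ∈ subtree R par b,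
      ∃ p : G.Walk x y, IsTotalRainbowPath (vertexColor R par κ) (edgeColor R par τ) p :=
    fun κ a ha b hb c hc hab hca hcb hτ x hx y hy =>
      F.exists_rainbow_direct ha hb hab hx hy fun e _ he =>
        Or.inl ⟨c, hc, hca, hcb, (Option.some.inj (hτ.symm.trans he)).symm⟩
  refine trc_le_of_colors_treeElements (κ := fun _ => some (Sum.inl a)) (τ := τ) ?_ ?_
    (F.isTRCColoring_of (by simp [hR]) ha hb hc (hd _ a ha b hb c hc hab hac.symm hbc.symm h1)
      (hd _ a ha c hc b hb hac hab.symm hbc h2) (hd _ b hb c hc a ha hbc hab hac h3))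
  · exact fun _ => ⟨_, h a ha, rfl⟩
  · intro e
    simp only [τ]
    split_ifs
    · exact ⟨_, h c hc, rfl⟩
    · exact ⟨_, h b hb, rfl⟩
    · exact ⟨_, h a ha, rfl⟩

/-- The edges from `u` to the trivial roots are colored like the bridges `t₂` and `t₃`, the third
edge like `d`, the trivial roots like `m`. A vertex below `t₂` reaches the corresponding trivial
root by the detour, whose colors `t₃`, `m`, `d` belong to bridges not above it; likewise for `t₃`.
All other pairs are joined directly. -/
theorem trc_le_of_one [Finite V] (F : TriangleForest G R par dep) (hu : u ∈ R)
    (htriv : ∀ r ∈ R, r ≠ u → r ∉ parents R par) {t₂ t₃ d m : V} (ht₂ : t₂ ∉ R) (ht₃ : t₃ ∉ R)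
    (hd : d ∉ R) (hm : m ∉ R) (hmd : m ≠ d)
    (h2 : ∀ x ∈ subtree R par t₂, x ∉ subtree R par t₃ ∧ x ∉ subtree R par d ∧
      x ∉ subtree R par m)
    (h3 : ∀ x ∈ subtree R par t₃, x ∉ subtree R par t₂ ∧ x ∉ subtree R par d ∧
      x ∉ subtree R par m) :
    trc G ≤ (treeElements R par).ncard := by
  classical
  obtain ⟨q, hq, r, hr, huq, hur, hqr, hR⟩ := F.exists_others hu
  let τ : Sym2 V → Option (V ⊕ V) := fun e =>
    if e = s(u, q) then some (Sum.inr t₂) else if e = s(u, r) then some (Sum.inr t₃)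
    else some (Sum.inr d)
  let κ : V → Option (V ⊕ V) := fun _ => some (Sum.inr m)
  have e1 : τ s(u, q) = some (Sum.inr t₂) := by simp [τ]
  have e2 : τ s(u, r) = some (Sum.inr t₃) := by simp [τ, huq, hqr.symm]
  have e3 : τ s(q, r) = some (Sum.inr d) := by simp [τ, huq.symm, hur.symm, hqr]
  have hroot : ∀ r ∈ R, ∀ t ∉ R, r ∉ subtree R par t := fun r hr t ht h =>
    ht (eq_of_root_mem_subtree h hr ▸ hr)
  have hself : ∀ r, r ∈ R → r ≠ u → ∀ y ∈ subtree R par r, y = r := fun r hr hru y hy =>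
    subtree_eq_of_not_parent (htriv r hr hru) hy
  have key : ∀ q ∈ R, ∀ r ∈ R, u ≠ q → u ≠ r → q ≠ r → ∀ t₂ ∉ R, ∀ t₃ ∉ R,
      (∀ x ∈ subtree R par t₂, x ∉ subtree R par t₃ ∧ x ∉ subtree R par d ∧
        x ∉ subtree R par m) →
      (∀ x ∈ subtree R par t₃, x ∉ subtree R par t₂ ∧ x ∉ subtree R par d ∧
        x ∉ subtree R par m) →
      τ s(u, q) = some (Sum.inr t₂) → τ s(u, r) = some (Sum.inr t₃) →
      τ s(q, r) = some (Sum.inr d) → ∀ x ∈ subtree R par u, ∀ y ∈ subtree R par q,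
      ∃ p : G.Walk x y, IsTotalRainbowPath (vertexColor R par κ) (edgeColor R par τ) p := by
    intro q hq r hr huq hur hqr t₂ ht₂ t₃ ht₃ h2 h3 e1 e2 e3 x hx y hy
    obtain rfl := hself q hq huq.symm y hy
    by_cases hxt : x ∈ subtree R par t₂
    · obtain ⟨h4, h5, h6⟩ := h2 x hxt
      refine F.exists_rainbow_indirect hu hq hr hur hqr.symm hx hy ht₃ hd ?_ e2
        (by rw [Sym2.eq_swap, e3]) h4 (hroot _ hq _ ht₃) h5 (hroot _ hq _ hd)
        (fun _ => ⟨m, hm, rfl, ?_, hmd, h6, hroot _ hq _ hm⟩)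
      · rintro rfl
        exact (h3 _ self_mem_subtree).2.1 self_mem_subtree
      · rintro rfl
        exact (h3 _ self_mem_subtree).2.2 self_mem_subtree
    · exact F.exists_rainbow_direct hu hq huq hx hy fun e _ he =>
        Or.inr ⟨t₂, ht₂, (Option.some.inj (e1.symm.trans he)).symm, hxt, hroot _ hq _ ht₂⟩
  refine trc_le_of_colors_treeElements (κ := κ) (τ := τ) ?_ ?_
    (F.isTRCColoring_of hR hu hq hr
      (key q hq r hr huq hur hqr t₂ ht₂ t₃ ht₃ h2 h3 e1 e2 e3)
      (key r hr q hq hur huq hqr.symm t₃ ht₃ t₂ ht₂ h3 h2 e2 e1 (by rw [Sym2.eq_swap, e3])) ?_)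
  · exact fun _ => ⟨_, hm, rfl⟩
  · intro e
    simp only [τ]
    split_ifs
    · exact ⟨_, ht₂, rfl⟩
    · exact ⟨_, ht₃, rfl⟩
    · exact ⟨_, hd, rfl⟩
  · intro x hx y hy
    obtain rfl := hself q hq huq.symm x hx
    obtain rfl := hself r hr hur.symm y hy
    exact F.exists_rainbow_direct hq hr hqr hx hy fun e _ he =>
      Or.inr ⟨d, hd, (Option.some.inj (e3.symm.trans he)).symm, hroot _ hq _ hd, hroot _ hr _ hd⟩

/-- The edges `u₁u₂`, `u₁u₃`, `u₂u₃` and the vertex `u₃` are colored like the bridges `t`, `t₁`,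
`t₂`, `m`, all in the tree of `u₁`. Vertices below `t` reach the tree of `u₂` through `u₃`. Vertices
below `t₁` reach `u₃` through `u₂`, which has its own color, so `m` is irrelevant there. The tree of
`u₂` reaches `u₃` directly, as `t₂` lies in the other tree. -/
theorem trc_le_of_two [Finite V] (F : TriangleForest G R par dep) {u₁ u₂ u₃ : V} (hu₁ : u₁ ∈ R)
    (hu₂ : u₂ ∈ R) (hu₃ : u₃ ∈ R) (h12 : u₁ ≠ u₂) (h13 : u₁ ≠ u₃) (h23 : u₂ ≠ u₃)
    (htriv : u₃ ∉ parents R par) (hnt : u₂ ∈ parents R par) {t t₁ t₂ m : V}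
    (hR : ∀ z ∈ R, z = u₁ ∨ z = u₂ ∨ z = u₃)
    (ht : t ∉ R) (ht₁ : t₁ ∉ R) (ht₂ : t₂ ∉ R) (hm : m ∉ R)
    (htu : t ∈ subtree R par u₁) (ht₁u : t₁ ∈ subtree R par u₁) (ht₂u : t₂ ∈ subtree R par u₁)
    (hmu : m ∈ subtree R par u₁) (hm₁ : m ≠ t₁) (hm₂ : m ≠ t₂)
    (h1 : ∀ x ∈ subtree R par t, x ∉ subtree R par t₁ ∧ x ∉ subtree R par t₂ ∧
      x ∉ subtree R par m)
    (h2 : ∀ x ∈ subtree R par t₁, x ∉ subtree R par t₂) :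
    trc G ≤ (treeElements R par).ncard := by
  classical
  let τ : Sym2 V → Option (V ⊕ V) := fun e =>
    if e = s(u₁, u₂) then some (Sum.inr t) else if e = s(u₁, u₃) then some (Sum.inr t₁)
    else some (Sum.inr t₂)
  let κ : V → Option (V ⊕ V) := fun _ => some (Sum.inr m)
  have e1 : τ s(u₁, u₂) = some (Sum.inr t) := by simp [τ]
  have e2 : τ s(u₁, u₃) = some (Sum.inr t₁) := by simp [τ, h12, h23.symm]
  have e3 : τ s(u₂, u₃) = some (Sum.inr t₂) := by simp [τ, h12.symm, h13.symm, h23]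
  have hroot : ∀ r ∈ R, ∀ t ∉ R, r ∉ subtree R par t := fun r hr t ht h =>
    ht (eq_of_root_mem_subtree h hr ▸ hr)
  have hout : ∀ y ∈ subtree R par u₂, ∀ t ∈ subtree R par u₁, y ∉ subtree R par t :=
    fun y hy t ht h => h12 (root_unique hu₁ hu₂ (subtree_trans h ht) hy)
  have hself : ∀ y ∈ subtree R par u₃, y = u₃ := fun y hy => subtree_eq_of_not_parent htriv hy
  have ht12 : t₁ ≠ t₂ := by
    rintro rfl
    exact h2 _ self_mem_subtree self_mem_subtree
  have htt₂ : t ≠ t₂ := by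
    rintro rfl
    exact (h1 _ self_mem_subtree).2.1 self_mem_subtree
  refine trc_le_of_colors_treeElements (κ := κ) (τ := τ) ?_ ?_
    (F.isTRCColoring_of hR hu₁ hu₂ hu₃ ?_ ?_ ?_)
  · exact fun _ => ⟨_, hm, rfl⟩
  · intro e
    simp only [τ]
    split_ifs
    · exact ⟨_, ht, rfl⟩
    · exact ⟨_, ht₁, rfl⟩
    · exact ⟨_, ht₂, rfl⟩
  · intro x hx y hy
    by_cases hxt : x ∈ subtree R par t
    · obtain ⟨h4, h5, h6⟩ := h1 x hxt
      exact F.exists_rainbow_indirect hu₁ hu₂ hu₃ h13 h23.symm hx hy ht₁ ht₂ ht12 e2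
        (by rw [Sym2.eq_swap, e3]) h4 (hout y hy _ ht₁u) h5 (hout y hy _ ht₂u)
        (fun _ => ⟨m, hm, rfl, hm₁, hm₂, h6, hout y hy _ hmu⟩)
    · exact F.exists_rainbow_direct hu₁ hu₂ h12 hx hy fun e _ he =>
        Or.inr ⟨t, ht, (Option.some.inj (e1.symm.trans he)).symm, hxt, hout y hy _ htu⟩
  · intro x hx y hy
    obtain rfl := hself y hy
    by_cases hxt : x ∈ subtree R par t₁
    · exact F.exists_rainbow_indirect hu₁ hu₃ hu₂ h12 h23 hx hy ht ht₂ htt₂ e1 e3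
        (fun h => (h1 x h).1 hxt) (hroot _ hu₃ _ ht) (h2 x hxt) (hroot _ hu₃ _ ht₂)
        (fun h => absurd hnt h)
    · exact F.exists_rainbow_direct hu₁ hu₃ h13 hx hy fun e _ he =>
        Or.inr ⟨t₁, ht₁, (Option.some.inj (e2.symm.trans he)).symm, hxt, hroot _ hu₃ _ ht₁⟩
  · intro x hx y hy
    obtain rfl := hself y hy
    exact F.exists_rainbow_direct hu₂ hu₃ h23 hx hy fun e _ he =>
      Or.inr ⟨t₂, ht₂, (Option.some.inj (e3.symm.trans he)).symm, hout x hx _ ht₂u,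
        hroot _ hu₃ _ ht₂⟩

/-! ### The lower bound, and the distribution of the leaves among the trees -/

theorem ncard_treeElements_le_trc [Finite V] (F : TriangleForest G R par dep)
    (hconn : G.Connected) : (treeElements R par).ncard ≤ trc G := by
  obtain ⟨cv, ce, hc⟩ := exists_coloring_trc hconn
  exact F.ncard_le_of_coloring hc

theorem treeLeaves_eq (F : TriangleForest G R par dep) (hu : u ∈ R) :
    treeLeaves G u = leaves G ∩ subtree R par u := by
  rw [treeLeaves, F.hangingTree_eq hu]

theorem mem_subtree_leaf_iff (F : TriangleForest G R par dep) (hv : v ∈ leaves G) :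
    w ∈ subtree R par v ↔ w = v :=
  ⟨F.eq_of_mem_subtree_leaf hv, fun h => h ▸ self_mem_subtree⟩

/-- Every leaf lies in a nontrivial tree. -/
theorem exists_nontrivialRoot (F : TriangleForest G R par dep) (hx : x ∈ leaves G) :
    ∃ u ∈ nontrivialRoots G, x ∈ treeLeaves G u := by
  obtain ⟨r, hr, h⟩ := F.exists_root x
  refine ⟨r, ?_, ?_⟩
  · rw [F.nontrivialRoots_eq]
    exact ⟨hr, exists_child h (fun e => (F.mem_leaves.1 hx).1 (e ▸ hr))⟩
  · rw [F.treeLeaves_eq hr]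
    exact ⟨hx, h⟩

theorem treeLeaves_nonempty [Finite V] (F : TriangleForest G R par dep)
    (hu : u ∈ nontrivialRoots G) : (treeLeaves G u).Nonempty := by
  rw [F.nontrivialRoots_eq] at hu
  rw [F.treeLeaves_eq hu.1]
  exact F.exists_leaf (Or.inr hu.2)

theorem treeLeaves_disjoint (F : TriangleForest G R par dep) (hu : u ∈ nontrivialRoots G)
    (hv : v ∈ nontrivialRoots G) (huv : u ≠ v) : Disjoint (treeLeaves G u) (treeLeaves G v) := by
  rw [F.nontrivialRoots_eq] at hu hv
  rw [F.treeLeaves_eq hu.1, F.treeLeaves_eq hv.1, Set.disjoint_left]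
  exact fun x h1 h2 => huv (root_unique hu.1 hv.1 h1.2 h2.2)

theorem leaves_eq_of_one (F : TriangleForest G R par dep) (hu : nontrivialRoots G = {u}) :
    leaves G = treeLeaves G u := by
  refine Set.Subset.antisymm (fun x hx => ?_) Set.inter_subset_left
  obtain ⟨v, hv, h⟩ := F.exists_nontrivialRoot hx
  rw [hu] at hv
  exact hv ▸ h

theorem ncard_leaves_of_two [Finite V] (F : TriangleForest G R par dep)
    (hu : nontrivialRoots G = {u, v}) (huv : u ≠ v) :
    (leaves G).ncard = (treeLeaves G u).ncard + (treeLeaves G v).ncard := by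
  rw [← Set.ncard_union_eq (F.treeLeaves_disjoint (hu ▸ Or.inl rfl) (hu ▸ Or.inr rfl) huv)]
  congr 1
  refine Set.Subset.antisymm (fun x hx => ?_) (Set.union_subset Set.inter_subset_left
    Set.inter_subset_left)
  obtain ⟨w, hw, h⟩ := F.exists_nontrivialRoot hx
  rw [hu] at hw
  rcases hw with rfl | rfl
  · exact Or.inl h
  · exact Or.inr h

theorem ncard_nontrivialRoots_le [Finite V] (F : TriangleForest G R par dep) :
    (nontrivialRoots G).ncard ≤ (leaves G).ncard := by
  choose! f hf using fun u (hu : u ∈ nontrivialRoots G) => F.treeLeaves_nonempty hu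
  refine Set.ncard_le_ncard_of_injOn f (fun u hu => (hf u hu).1) (fun u hu v hv h => ?_)
  by_contra hne
  exact Set.disjoint_left.1 (F.treeLeaves_disjoint hu hv hne) (hf u hu) (h ▸ hf v hv)

theorem ncard_nontrivialRoots_le_three (F : TriangleForest G R par dep) :
    (nontrivialRoots G).ncard ≤ 3 := by
  rw [F.nontrivialRoots_eq, ← F.card_roots, ← Set.ncard_coe_finset]
  exact Set.ncard_le_ncard Set.inter_subset_left

/-! ### One nontrivial tree -/

theorem mem_subtree_of_mem_support_path (F : TriangleForest G R par dep) (hu : u ∈ R)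
    {p : (cycleDeleted G).Walk u w} (hp : p.IsPath) {s : V} (hs : s ∈ p.support) :
    w ∈ subtree R par s := by
  classical
  by_cases hsR : s ∈ R
  · have h1 : s ∈ hangingTree G u := ⟨p.takeUntil s hs⟩
    have h2 : w ∈ hangingTree G u := ⟨p⟩
    rw [F.hangingTree_eq hu] at h1 h2
    rwa [eq_of_root_mem_subtree h1 hsR]
  · have hle : cycleDeleted G ≤ G := deleteEdges_le _
    rcases F.mem_subtree_of_mem_support hsR (p.mapLe hle)
      ((Walk.isPath_mapLe hle).2 hp).isTrail (by simpa using hs) with h | h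
    · exact absurd (eq_of_root_mem_subtree h hu ▸ hu) hsR
    · exact h

/-- In a graph of the class `ClassG13'` no leaf is the only leaf below its parent. -/
theorem exists_leaf_of_classG13' [Finite V] (F : TriangleForest G R par dep) (h : ClassG13' G)
    {t : V} (ht : t ∈ leaves G) : ∃ t' ∈ leaves G, t' ≠ t ∧ t' ∈ subtree R par (par t) := by
  obtain ⟨⟨-, -, -, h3⟩, u, hu, w, p, x, y, z, hp, hx, hy, hz, hxy, hxz, hyz, hwx, hwy, s, hs,
    hsz⟩ := h
  rw [F.nontrivialRoots_eq] at hu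
  rw [F.leaf_adj_iff hx] at hwx
  rw [F.leaf_adj_iff hy] at hwy
  rw [F.leaf_adj_iff hz] at hsz
  have hall : ({x, y, z} : Set V) = leaves G := by
    refine Set.eq_of_subset_of_ncard_le ?_ ?_
    · rintro _ (rfl | rfl | rfl) <;> assumption
    · rw [h3, Set.ncard_eq_three.2 ⟨x, y, z, hxy, hxz, hyz, rfl⟩]
  have hxw : x ∈ subtree R par w := hwx ▸ mem_subtree_par (F.mem_leaves.1 hx).1
  have hyw : y ∈ subtree R par w := hwy ▸ mem_subtree_par (F.mem_leaves.1 hy).1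
  rw [← hall] at ht
  rcases ht with rfl | rfl | rfl
  · exact ⟨y, hy, hxy.symm, hwx ▸ hyw⟩
  · exact ⟨x, hx, hxy, hwy ▸ hxw⟩
  · exact ⟨x, hx, hxz, hsz ▸ subtree_trans hxw (F.mem_subtree_of_mem_support_path hu.1 hp hs)⟩

/-- Take a leaf `x` whose parent is deepest. A second leaf `y` below `par x` must have the same
parent. For the third leaf `z`, any other leaf below `par z` puts `par x` below `par z`, so `par z`
is on the path from the root to `par x`. -/
theorem classG13'_of [Finite V] (F : TriangleForest G R par dep) (hG : ClassG 1 3 G)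
    (h : ∀ t ∈ leaves G, ∃ t' ∈ leaves G, t' ≠ t ∧ t' ∈ subtree R par (par t)) :
    ClassG13' G := by
  classical
  obtain ⟨-, -, h1, h3⟩ := id hG
  obtain ⟨u, hu⟩ := Set.ncard_eq_one.1 h1
  have huN : u ∈ nontrivialRoots G := hu ▸ rfl
  have huR : u ∈ R := by
    rw [F.nontrivialRoots_eq] at huN
    exact huN.1
  obtain ⟨x, hx, hmax⟩ := Set.exists_max_image (leaves G) (fun t => dep (par t)) (Set.toFinite _)
    (Set.nonempty_of_ncard_ne_zero (by omega))
  obtain ⟨y, hy, hyx, hyp⟩ := h x hx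
  have hyp' : par y ∈ subtree R par (par x) := par_mem_subtree hyp (fun e =>
    (F.mem_leaves.1 hy).2 ⟨x, (F.mem_leaves.1 hx).1, e.symm⟩)
  have hpar : par y = par x := F.eq_of_dep hyp' (hmax y hy)
  obtain ⟨z, hz, hzxy⟩ : ∃ z ∈ leaves G, z ∉ ({x, y} : Set V) :=
    Set.exists_mem_notMem_of_ncard_lt_ncard (by rw [h3, Set.ncard_pair hyx.symm]; omega)
  simp only [Set.mem_insert_iff, Set.mem_singleton_iff, not_or] at hzxy
  have hall : ({x, y, z} : Set V) = leaves G := by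
    refine Set.eq_of_subset_of_ncard_le ?_ ?_
    · rintro _ (rfl | rfl | rfl) <;> assumption
    · rw [h3, Set.ncard_eq_three.2 ⟨x, y, z, hyx.symm, Ne.symm hzxy.1, Ne.symm hzxy.2, rfl⟩]
  have hzs : par x ∈ subtree R par (par z) := by
    obtain ⟨t, ht, htz, htp⟩ := h z hz
    have hpt : par t ∈ subtree R par (par z) := par_mem_subtree htp (fun e =>
      (F.mem_leaves.1 ht).2 ⟨z, (F.mem_leaves.1 hz).1, e.symm⟩)
    rw [← hall] at ht
    rcases ht with rfl | rfl | rfl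
    · exact hpt
    · rwa [hpar] at hpt
    · exact absurd rfl htz
  have hxu : x ∈ subtree R par u := by
    have := F.leaves_eq_of_one hu ▸ hx
    rw [F.treeLeaves_eq huR] at this
    exact this.2
  have hne : ∀ t ∈ leaves G, t ≠ u := fun t ht e => (F.mem_leaves.1 ht).1 (e ▸ huR)
  have hxpu := par_mem_subtree hxu (hne x hx)
  obtain ⟨q⟩ := (F.cycleDeleted_reachable hxpu).symm
  refine ⟨hG, u, huN, par x, q.bypass, x, y, z, q.bypass_isPath, hx, hy, hz, hyx.symm,
    Ne.symm hzxy.1, Ne.symm hzxy.2, (F.adj_par (F.mem_leaves.1 hx).1).symm,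
    hpar ▸ (F.adj_par (F.mem_leaves.1 hy).1).symm, par z, ?_,
    (F.adj_par (F.mem_leaves.1 hz).1).symm⟩
  by_cases hzu : par z = u
  · rw [hzu]
    exact Walk.start_mem_support _
  · have hle : cycleDeleted G ≤ G := deleteEdges_le _
    have hzu' : u ∉ subtree R par (par z) := fun h =>
      hzu (eq_of_root_mem_subtree h huR).symm
    have := F.mem_support_of_leaves (q.bypass.mapLe hle).reverse hzs hzu'
    simpa using this

theorem trc_le_iff_of_one [Finite V] (F : TriangleForest G R par dep) (hconn : G.Connected)
    (huni : IsUnicyclic G) (hcirc : circumference G = 3) (h1 : (nontrivialRoots G).ncard = 1) :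
    trc G ≤ (treeElements R par).ncard ↔ 3 ≤ (leaves G).ncard ∧ ¬ ClassG13' G := by
  obtain ⟨u, hu⟩ := Set.ncard_eq_one.1 h1
  have huN : u ∈ (↑R ∩ parents R par : Set V) := by
    rw [← F.nontrivialRoots_eq, hu]
    rfl
  constructor
  · intro hk
    obtain ⟨cv, ce, hc⟩ := exists_coloring_trc hconn
    obtain ⟨c₂, hc₂, c₃, hc₃, d, hd, a₃, ha₃, a₂, ha₂, H2, H3⟩ := F.exists_elements_of_one hc hk hu
    obtain ⟨x₂, hx₂, h2⟩ := F.exists_leaf_base hc₂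
    obtain ⟨x₃, hx₃, h3⟩ := F.exists_leaf_base hc₃
    obtain ⟨y, hy, hyd⟩ := F.exists_leaf_base hd
    obtain ⟨h23, h2d, h2a, ha₃c, ha₃d⟩ := H2 x₂ hx₂ h2
    obtain ⟨h32, h3d, h3a, ha₂c, ha₂d⟩ := H3 x₃ hx₃ h3
    have hy2 : y ∉ subtree R par (base c₂) := fun h => (H2 y hy h).2.1 hyd
    have hy3 : y ∉ subtree R par (base c₃) := fun h => (H3 y hy h).2.1 hyd
    have n23 : x₂ ≠ x₃ := fun h => h23 (h ▸ h3)
    have n2y : x₂ ≠ y := fun h => hy2 (h ▸ h2)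
    have n3y : x₃ ≠ y := fun h => hy3 (h ▸ h3)
    have hsub : ({x₂, x₃, y} : Set V) ⊆ leaves G := by
      rintro _ (rfl | rfl | rfl) <;> assumption
    have hcard := Set.ncard_eq_three.2 ⟨x₂, x₃, y, n23, n2y, n3y, rfl⟩
    refine ⟨hcard ▸ Set.ncard_le_ncard hsub, fun hcls => ?_⟩
    have hall : ({x₂, x₃, y} : Set V) = leaves G :=
      Set.eq_of_subset_of_ncard_le hsub (by rw [hcls.1.2.2.2, hcard])
    -- An element with a single leaf `t` below it is the pendent edge at `t`: otherwise it is above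
    -- `par t`, and in this class another leaf lies below `par t`.
    have hsingle : ∀ e ∈ treeElements R par, ∀ t ∈ leaves G, t ∈ subtree R par (base e) →
        (∀ t' ∈ leaves G, t' ≠ t → t' ∉ subtree R par (base e)) → e = Sum.inr t := by
      intro e he t ht hte honly
      by_cases hbt : base e = t
      · rcases e with v | v
        · exact absurd (show t ∈ parents R par from (show v = t from hbt) ▸ he)
            (F.mem_leaves.1 ht).2
        · exact congrArg Sum.inr hbt
      · obtain ⟨t', ht', hne, hmem⟩ := F.exists_leaf_of_classG13' hcls ht
        exact absurd (subtree_trans hmem (par_mem_subtree hte (Ne.symm hbt))) (honly t' ht' hne)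
    have hforall : ∀ P : V → Prop, P x₂ → P x₃ → P y → ∀ t ∈ leaves G, P t := by
      intro P p2 p3 py t ht
      rw [← hall] at ht
      rcases ht with rfl | rfl | rfl <;> assumption
    have e2 := hsingle c₂ hc₂ x₂ hx₂ h2 (hforall _ (by tauto) (by tauto) (by tauto))
    have e3 := hsingle c₃ hc₃ x₃ hx₃ h3 (hforall _ (by tauto) (by tauto) (by tauto))
    have ed := hsingle d hd y hy hyd (hforall _ (by tauto) (by tauto) (by tauto))
    -- The element `a₃` misses `x₂` and differs from the pendent edges `c₃` and `d`, so it is above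
    -- both `x₃` and `y`. Similarly `a₂` is above `x₂` and `y`. Both being above `y`, they are
    -- comparable, and the higher one is above the leaf it should miss.
    have key3 : x₃ ∈ subtree R par (base a₃) ∧ y ∈ subtree R par (base a₃) := by
      by_contra hcon
      have hex := F.exists_leaf_base ha₃
      rw [← hall] at hex
      obtain ⟨t, rfl | rfl | rfl, h⟩ := hex
      · exact h2a h
      · exact ha₃c (e3 ▸ hsingle a₃ ha₃ t hx₃ h (hforall _ (by tauto) (by tauto) (by tauto)))
      · exact ha₃d (ed ▸ hsingle a₃ ha₃ t hy h (hforall _ (by tauto) (by tauto) (by tauto)))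
    have key2 : x₂ ∈ subtree R par (base a₂) ∧ y ∈ subtree R par (base a₂) := by
      by_contra hcon
      have hex := F.exists_leaf_base ha₂
      rw [← hall] at hex
      obtain ⟨t, rfl | rfl | rfl, h⟩ := hex
      · exact ha₂c (e2 ▸ hsingle a₂ ha₂ t hx₂ h (hforall _ (by tauto) (by tauto) (by tauto)))
      · exact h3a h
      · exact ha₂d (ed ▸ hsingle a₂ ha₂ t hy h (hforall _ (by tauto) (by tauto) (by tauto)))
    rcases subtree_comparable key3.2 key2.2 with h | h
    · exact h3a (subtree_trans key3.1 h)
    · exact h2a (subtree_trans key2.1 h)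
  · rintro ⟨h3, hcls⟩
    have htriv : ∀ r ∈ R, r ≠ u → r ∉ parents R par := fun r hr hne hp =>
      hne (show r ∈ ({u} : Set V) from hu ▸ F.nontrivialRoots_eq ▸ ⟨hr, hp⟩)
    have hL : ∀ t ∈ leaves G, t ∈ subtree R par u := by
      intro t ht
      have := F.leaves_eq_of_one hu ▸ ht
      rw [F.treeLeaves_eq huN.1] at this
      exact this.2
    rcases h3.lt_or_eq with h4 | h3
    -- With four leaves, four pendent edges supply all the colors.
    · obtain ⟨x, y, z, hx, hy, hz, hxy, hxz, hyz⟩ :=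
        (Set.two_lt_ncard_iff (s := leaves G)).1 (by omega)
      obtain ⟨t, ht, htn⟩ : ∃ t ∈ leaves G, t ∉ ({x, y, z} : Set V) :=
        Set.exists_mem_notMem_of_ncard_lt_ncard
          (by rw [Set.ncard_eq_three.2 ⟨x, y, z, hxy, hxz, hyz, rfl⟩]; omega)
      simp only [Set.mem_insert_iff, Set.mem_singleton_iff, not_or] at htn
      refine F.trc_le_of_one huN.1 htriv (t₂ := x) (t₃ := y) (d := z) (m := t)
        (F.mem_leaves.1 hx).1 (F.mem_leaves.1 hy).1 (F.mem_leaves.1 hz).1 (F.mem_leaves.1 ht).1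
        htn.2.2 ?_ ?_
      · simp only [F.mem_subtree_leaf_iff, hx, hy, hz, ht]
        rintro _ rfl
        exact ⟨hxy, hxz, Ne.symm htn.1⟩
      · simp only [F.mem_subtree_leaf_iff, hx, hy, hz, ht]
        rintro _ rfl
        exact ⟨hxy.symm, hyz, Ne.symm htn.2.1⟩
    · have hns := mt (F.classG13'_of ⟨huni, hcirc, h1, h3.symm⟩) hcls
      push Not at hns
      obtain ⟨t, ht, hns⟩ := hns
      obtain ⟨x, hx, hxt⟩ : ∃ x ∈ leaves G, x ∉ ({t} : Set V) :=
        Set.exists_mem_notMem_of_ncard_lt_ncard (by rw [Set.ncard_singleton]; omega)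
      rw [Set.mem_singleton_iff] at hxt
      obtain ⟨y, hy, hyn⟩ : ∃ y ∈ leaves G, y ∉ ({t, x} : Set V) :=
        Set.exists_mem_notMem_of_ncard_lt_ncard (by rw [Set.ncard_pair (Ne.symm hxt)]; omega)
      simp only [Set.mem_insert_iff, Set.mem_singleton_iff, not_or] at hyn
      have htR := (F.mem_leaves.1 ht).1
      -- Here `t` is the only leaf below its parent, so the bridge above `par t` is the fourth one.
      -- It exists because a root as parent of `t` would have all leaves below it.
      refine F.trc_le_of_one huN.1 htriv (t₂ := x) (t₃ := y) (d := t) (m := par t)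
        (F.mem_leaves.1 hx).1 (F.mem_leaves.1 hy).1 htR ?_ (F.par_ne htR) ?_ ?_
      · intro hpR
        have := root_unique hpR huN.1 (mem_subtree_par htR) (hL t ht)
        exact hns x hx hxt (this ▸ hL x hx)
      · simp only [F.mem_subtree_leaf_iff, hx, hy, ht]
        rintro _ rfl
        exact ⟨Ne.symm hyn.2, hxt, hns _ hx hxt⟩
      · simp only [F.mem_subtree_leaf_iff, hx, hy, ht]
        rintro _ rfl
        exact ⟨hyn.2, hyn.1, hns _ hy hyn.1⟩

/-! ### Two nontrivial trees -/

theorem trc_le_iff_of_two [Finite V] (F : TriangleForest G R par dep) (hconn : G.Connected)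
    (h2 : (nontrivialRoots G).ncard = 2) :
    trc G ≤ (treeElements R par).ncard ↔
      ∃ u ∈ nontrivialRoots G, 3 ≤ (treeLeaves G u).ncard ∧ ¬ IsTripleBroom G u := by
  constructor
  · intro hk
    obtain ⟨cv, ce, hc⟩ := exists_coloring_trc hconn
    obtain ⟨u, hu, c, hc₀, c', hc', d, hd, a, ha, hac', had, H1, H2, H3⟩ :=
      F.exists_elements_of_two hc hk h2
    have huR : u ∈ R := by
      rw [F.nontrivialRoots_eq] at hu
      exact hu.1
    obtain ⟨x, hx, hxc⟩ := F.exists_leaf_base hc₀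
    obtain ⟨y, hy, hyc⟩ := F.exists_leaf_base hc'
    obtain ⟨z, hz, hzd⟩ := F.exists_leaf_base hd
    obtain ⟨hxc', hxd, hxa⟩ := H2 x hx hxc
    have hyd := H3 y hy hyc
    have hyc₀ : y ∉ subtree R par (base c) := fun h => (H2 y hy h).1 hyc
    have hzc₀ : z ∉ subtree R par (base c) := fun h => (H2 z hz h).2.1 hzd
    have hzc' : z ∉ subtree R par (base c') := fun h => H3 z hz h hzd
    have nxy : x ≠ y := fun h => hyc₀ (h ▸ hxc)
    have nxz : x ≠ z := fun h => hzc₀ (h ▸ hxc)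
    have nyz : y ≠ z := fun h => hzc' (h ▸ hyc)
    have hsub : ({x, y, z} : Set V) ⊆ treeLeaves G u := by
      rw [F.treeLeaves_eq huR]
      rintro _ (rfl | rfl | rfl)
      · exact ⟨hx, H1 c (by tauto) _ hx hxc⟩
      · exact ⟨hy, H1 c' (by tauto) _ hy hyc⟩
      · exact ⟨hz, H1 d (by tauto) _ hz hzd⟩
    have hcard := Set.ncard_eq_three.2 ⟨x, y, z, nxy, nxz, nyz, rfl⟩
    refine ⟨u, hu, hcard ▸ Set.ncard_le_ncard hsub, ?_⟩
    rintro ⟨hb3, w, hw⟩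
    have hall : ({x, y, z} : Set V) = treeLeaves G u :=
      Set.eq_of_subset_of_ncard_le hsub (by rw [hb3, hcard])
    rw [← hall] at hw
    have hwx := (F.leaf_adj_iff hx).1 (hw x (by simp))
    have hwy := (F.leaf_adj_iff hy).1 (hw y (by simp))
    have hwz := (F.leaf_adj_iff hz).1 (hw z (by simp))
    have hxw : x ∈ subtree R par w := hwx ▸ mem_subtree_par (F.mem_leaves.1 hx).1
    have hyw : y ∈ subtree R par w := hwy ▸ mem_subtree_par (F.mem_leaves.1 hy).1
    have hzw : z ∈ subtree R par w := hwz ▸ mem_subtree_par (F.mem_leaves.1 hz).1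
    -- In a broom, an element above some but not all of the three bristles is a pendent edge. This
    -- leaves nothing for `a`, which must miss `x` and differ from the pendent edges at `y` and `z`.
    have hsingle : ∀ e ∈ treeElements R par, ∀ t ∈ leaves G, w = par t →
        t ∈ subtree R par (base e) → (x ∉ subtree R par (base e) ∨ y ∉ subtree R par (base e) ∨
          z ∉ subtree R par (base e)) → e = Sum.inr t := by
      intro e he t ht hwt hte hnot
      by_cases hbt : base e = t
      · rcases e with v | v
        · exact absurd (show t ∈ parents R par from (show v = t from hbt) ▸ he)
            (F.mem_leaves.1 ht).2
        · exact congrArg Sum.inr hbt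
      · have hwe : w ∈ subtree R par (base e) := hwt ▸ par_mem_subtree hte (Ne.symm hbt)
        rcases hnot with h | h | h
        · exact absurd (subtree_trans hxw hwe) h
        · exact absurd (subtree_trans hyw hwe) h
        · exact absurd (subtree_trans hzw hwe) h
    have ey := hsingle c' hc' y hy hwy hyc (Or.inl hxc')
    have ez := hsingle d hd z hz hwz hzd (Or.inl hxd)
    obtain ⟨t, ht, hta⟩ := F.exists_leaf_base ha
    have htu : t ∈ treeLeaves G u := by
      rw [F.treeLeaves_eq huR]
      exact ⟨ht, H1 a (by tauto) _ ht hta⟩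
    rw [← hall] at htu
    rcases htu with rfl | rfl | rfl
    · exact hxa hta
    · exact hac' (ey ▸ hsingle a ha t ht hwy hta (Or.inl hxa))
    · exact had (ez ▸ hsingle a ha t ht hwz hta (Or.inl hxa))
  · rintro ⟨u, hu, h3, hb⟩
    obtain ⟨u₂, hu₂, hne, hu₂'⟩ : ∃ v ∈ nontrivialRoots G, u ≠ v ∧
        ∀ z ∈ nontrivialRoots G, z = u ∨ z = v := by
      obtain ⟨a, b, hab, h⟩ := Set.ncard_eq_two.1 h2
      rw [h] at hu ⊢
      rcases hu with rfl | rfl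
      · exact ⟨b, by simp, hab, by simp⟩
      · exact ⟨a, by simp, hab.symm, by simp [or_comm]⟩
    rw [F.nontrivialRoots_eq] at hu hu₂ hu₂'
    obtain ⟨u₃, hu₃, h31, h32, hR⟩ := F.exists_third hu.1 hu₂.1 hne
    have htriv : u₃ ∉ parents R par := fun h => (hu₂' u₃ ⟨hu₃, h⟩).elim h31 h32
    have hTL := F.treeLeaves_eq hu.1
    rcases h3.lt_or_eq with h4 | h3
    · obtain ⟨x, y, z, hx, hy, hz, hxy, hxz, hyz⟩ :=
        (Set.two_lt_ncard_iff (s := treeLeaves G u)).1 (by omega)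
      obtain ⟨t, ht, htn⟩ : ∃ t ∈ treeLeaves G u, t ∉ ({x, y, z} : Set V) :=
        Set.exists_mem_notMem_of_ncard_lt_ncard
          (by rw [Set.ncard_eq_three.2 ⟨x, y, z, hxy, hxz, hyz, rfl⟩]; omega)
      simp only [Set.mem_insert_iff, Set.mem_singleton_iff, not_or] at htn
      rw [hTL] at hx hy hz ht
      refine F.trc_le_of_two hu.1 hu₂.1 hu₃ hne h31.symm h32.symm htriv hu₂.2 hR
        (t := x) (t₁ := y) (t₂ := z) (m := t) (F.mem_leaves.1 hx.1).1 (F.mem_leaves.1 hy.1).1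
        (F.mem_leaves.1 hz.1).1 (F.mem_leaves.1 ht.1).1 hx.2 hy.2 hz.2 ht.2 htn.2.1 htn.2.2 ?_ ?_
      · simp only [F.mem_subtree_leaf_iff, hx.1, hy.1, hz.1, ht.1]
        rintro _ rfl
        exact ⟨hxy, hxz, Ne.symm htn.1⟩
      · simp only [F.mem_subtree_leaf_iff, hy.1, hz.1]
        rintro _ rfl
        exact hyz
    · -- a leaf `x` whose parent is not above some other leaf `t`
      obtain ⟨x, hx, t, ht, hxt⟩ : ∃ x ∈ treeLeaves G u, ∃ t ∈ treeLeaves G u,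
          t ∉ subtree R par (par x) := by
        -- If the parent of each leaf were above all leaves, the parents would be mutual ancestors,
        -- hence equal, and the tree would be a broom.
        by_contra hcon
        push Not at hcon
        obtain ⟨x, hx⟩ := Set.nonempty_of_ncard_ne_zero (s := treeLeaves G u) (by omega)
        refine hb ⟨h3.symm, par x, fun y hy => ?_⟩
        have hpar : ∀ x ∈ treeLeaves G u, ∀ y ∈ treeLeaves G u,
            par y ∈ subtree R par (par x) := fun x hx y hy =>
          par_mem_subtree (hcon x hx y hy) (fun e =>
            (F.mem_leaves.1 hy.1).2 ⟨x, (F.mem_leaves.1 hx.1).1, e.symm⟩)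
        rw [F.leaf_adj_iff hy.1]
        exact F.subtree_antisymm (hpar y hy x hx) (hpar x hx y hy)
      obtain ⟨y, hy, hyt⟩ : ∃ y ∈ treeLeaves G u, y ∉ ({t} : Set V) :=
        Set.exists_mem_notMem_of_ncard_lt_ncard (by rw [Set.ncard_singleton]; omega)
      rw [Set.mem_singleton_iff] at hyt
      obtain ⟨z, hz, hzn⟩ : ∃ z ∈ treeLeaves G u, z ∉ ({t, y} : Set V) :=
        Set.exists_mem_notMem_of_ncard_lt_ncard (by rw [Set.ncard_pair (Ne.symm hyt)]; omega)
      simp only [Set.mem_insert_iff, Set.mem_singleton_iff, not_or] at hzn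
      rw [hTL] at hx hy hz ht
      have hxR := (F.mem_leaves.1 hx.1).1
      have hxu : x ≠ u := fun e => hxR (e ▸ hu.1)
      have hpu := par_mem_subtree hx.2 hxu
      have hpl : ∀ y ∈ leaves G, par x ≠ y := fun y hy e => (F.mem_leaves.1 hy).2 ⟨x, hxR, e⟩
      -- Only vertices below `t` detour through `u₃`, so the bridge above `par x` can color `u₃` as
      -- soon as it misses `t`. The leaf `x` may coincide with `y` or `z`.
      refine F.trc_le_of_two hu.1 hu₂.1 hu₃ hne h31.symm h32.symm htriv hu₂.2 hR
        (t := t) (t₁ := y) (t₂ := z) (m := par x) (F.mem_leaves.1 ht.1).1 (F.mem_leaves.1 hy.1).1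
        (F.mem_leaves.1 hz.1).1 ?_ ht.2 hy.2 hz.2 hpu (hpl y hy.1) (hpl z hz.1) ?_ ?_
      · intro hpR
        have := eq_of_root_mem_subtree hpu hpR
        exact hxt (this ▸ ht.2)
      · simp only [F.mem_subtree_leaf_iff, hy.1, hz.1, ht.1]
        rintro _ rfl
        exact ⟨Ne.symm hyt, Ne.symm hzn.1, hxt⟩
      · simp only [F.mem_subtree_leaf_iff, hy.1, hz.1]
        rintro _ rfl
        exact Ne.symm hzn.2

/-! ### Hanging paths -/

theorem exists_dep_eq (F : TriangleForest G R par dep) (hu : u ∈ R) (h : w ∈ subtree R par u)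
    {k : ℕ} (hk : k ≤ dep w) : ∃ v ∈ subtree R par u, dep v = k := by
  induction h using ReflTransGen.head_induction_on with
  | refl =>
    rw [F.dep_root u hu] at hk
    exact ⟨u, self_mem_subtree, by rw [F.dep_root u hu]; omega⟩
  | @head a c h h' ih =>
    obtain ⟨h1, rfl⟩ := h
    rcases hk.lt_or_eq with h2 | h2
    · exact ih (by have := F.dep_par a h1; omega)
    · exact ⟨a, mem_subtree_of_par h1 h', h2.symm⟩

/-- An interior vertex of the path has two neighbors, so only the far end can be a leaf. Conversely,
if `x` is the only leaf, every vertex of the tree is an ancestor of `x`; these form a chain, on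
which depth is an isomorphism onto the path with `dep x + 1` vertices. -/
theorem classB_iff [Finite V] (F : TriangleForest G R par dep) (huni : IsUnicyclic G)
    (hcirc : circumference G = 3) :
    ClassB 3 G ↔ (nontrivialRoots G).ncard = 1 ∧ (leaves G).ncard = 1 := by
  constructor
  · rintro ⟨-, -, u, hu, m, f, hf⟩
    have hN : (nontrivialRoots G).ncard = 1 := by rw [hu, Set.ncard_singleton]
    refine ⟨hN, le_antisymm ?_ (hN ▸ F.ncard_nontrivialRoots_le)⟩
    have huR : u ∈ R := by
      have : u ∈ nontrivialRoots G := hu ▸ rfl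
      rw [F.nontrivialRoots_eq] at this
      exact this.1
    have hsub : leaves G ⊆ {((f (Fin.last (m + 1)) : hangingTree G u) : V)} := by
      intro v hv
      have hvu : v ∈ hangingTree G u := (F.leaves_eq_of_one hu ▸ hv : v ∈ treeLeaves G u).2
      obtain ⟨i, hi⟩ := f.surjective ⟨v, hvu⟩
      by_contra hne
      have hi0 : i ≠ 0 := by
        rintro rfl
        rw [hi] at hf
        exact (F.mem_leaves.1 hv).1 ((show v = u from hf) ▸ huR)
      have hil : i ≠ Fin.last (m + 1) := by
        rintro rfl
        exact hne (by rw [hi]; rfl)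
      have hi0' : i.val ≠ 0 := fun h => hi0 (Fin.ext h)
      have hil' : i.val ≠ m + 1 := fun h => hil (Fin.ext h)
      have hadj : ∀ j, (pathGraph (m + 2)).Adj i j → G.Adj v (f j : hangingTree G u) := by
        intro j hj
        have := f.map_rel_iff.2 hj
        rw [hi] at this
        exact deleteEdges_le _ (show (cycleDeleted G).Adj v _ from this)
      have h1 := hadj ⟨i.val - 1, by omega⟩
        (by rw [pathGraph_adj]; right; simp only []; omega)
      have h2 := hadj ⟨i.val + 1, by omega⟩ (by rw [pathGraph_adj]; left; rfl)
      have h3 := f.injective (Subtype.ext (hv.unique h1 h2))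
      have := congrArg Fin.val h3
      simp only [] at this
      omega
    simpa using Set.ncard_le_ncard hsub
  · rintro ⟨h1, h2⟩
    obtain ⟨u, hu⟩ := Set.ncard_eq_one.1 h1
    obtain ⟨x, hx⟩ := Set.ncard_eq_one.1 h2
    have huR : u ∈ R := by
      have : u ∈ nontrivialRoots G := hu ▸ rfl
      rw [F.nontrivialRoots_eq] at this
      exact this.1
    have huP : u ∈ parents R par := by
      have : u ∈ nontrivialRoots G := hu ▸ rfl
      rw [F.nontrivialRoots_eq] at this
      exact this.2
    have hxL : x ∈ leaves G := hx ▸ rfl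
    have hxR := (F.mem_leaves.1 hxL).1
    have hbelow : ∀ v ∈ subtree R par u, x ∈ subtree R par v := by
      intro v hv
      obtain ⟨y, hy, h⟩ := F.exists_leaf (v := v) (by
        by_cases hvR : v ∈ R
        · exact Or.inr (eq_of_root_mem_subtree hv hvR ▸ huP)
        · exact Or.inl hvR)
      rw [hx] at hy
      exact (show y = x from hy) ▸ h
    have hxu : x ∈ subtree R par u := hbelow u self_mem_subtree
    have hinj : ∀ v ∈ subtree R par u, ∀ w ∈ subtree R par u, dep v = dep w → v = w := by
      intro v hv w hw h
      rcases subtree_comparable (hbelow v hv) (hbelow w hw) with h' | h'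
      · exact F.eq_of_dep h' h.le
      · exact (F.eq_of_dep h' h.ge).symm
    have hdx := F.dep_par x hxR
    obtain ⟨m, hm⟩ : ∃ m, dep x = m + 1 := ⟨_, hdx⟩
    have hH := F.hangingTree_eq huR
    have hmem : ∀ v : hangingTree G u, (v : V) ∈ subtree R par u := fun v => hH ▸ v.2
    let g : hangingTree G u → Fin (m + 2) := fun v =>
      ⟨dep v, by have := F.dep_le (hbelow v (hmem v)); omega⟩
    have hg : Function.Bijective g := by
      constructor
      · intro v w h
        exact Subtype.ext (hinj v (hmem v) w (hmem w) (congrArg Fin.val h))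
      · intro k
        obtain ⟨v, hv, h⟩ := F.exists_dep_eq huR hxu (k := k.val) (by have := k.2; omega)
        exact ⟨⟨v, hH ▸ hv⟩, Fin.ext h⟩
    have hadj : ∀ v ∈ subtree R par u, ∀ w ∈ subtree R par u, dep v + 1 = dep w →
        w ∉ R ∧ v = par w := by
      intro v hv w hw h
      have hwR : w ∉ R := fun h' => by
        have := F.dep_root w h'
        omega
      have hwu : w ≠ u := fun e => hwR (e ▸ huR)
      have := F.dep_par w hwR
      exact ⟨hwR, hinj v hv _ (par_mem_subtree hw hwu) (by omega)⟩
    let f : (cycleDeleted G).induce (hangingTree G u) ≃g pathGraph (m + 2) :=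
      { toEquiv := Equiv.ofBijective g hg
        map_rel_iff' := by
          intro v w
          rw [pathGraph_adj, comap_adj]
          change (dep v + 1 = dep w ∨ dep w + 1 = dep v) ↔ (cycleDeleted G).Adj v w
          rw [F.cycleDeleted_adj]
          refine or_congr ⟨hadj v (hmem v) w (hmem w), ?_⟩ ⟨hadj w (hmem w) v (hmem v), ?_⟩
          · rintro ⟨h, h'⟩
            rw [h', F.dep_par _ h]
          · rintro ⟨h, h'⟩
            rw [h', F.dep_par _ h] }
    refine ⟨huni, hcirc, u, hu, m, f.symm, ?_⟩
    have h0 : f ⟨u, hH ▸ self_mem_subtree⟩ = 0 := Fin.ext (F.dep_root u huR)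
    rw [← h0, RelIso.symm_apply_apply]

/-- Without a nontrivial tree every vertex is a root, and `G` is a complete graph on three vertices,
that is, a cycle. -/
theorem nontrivialRoots_ncard_pos [Fintype V] (F : TriangleForest G R par dep)
    (hcyc : ¬ Nonempty (G ≃g cycleGraph (Fintype.card V))) : 0 < (nontrivialRoots G).ncard := by
  classical
  rw [Nat.pos_iff_ne_zero, Ne, Set.ncard_eq_zero]
  intro h0
  apply hcyc
  have hall : ∀ v, v ∈ R := by
    intro v
    obtain ⟨r, hr, h⟩ := F.exists_root v
    by_contra hv
    have : r ∈ nontrivialRoots G := by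
      rw [F.nontrivialRoots_eq]
      exact ⟨hr, exists_child h (fun e => hv (e ▸ hr))⟩
    rw [h0] at this
    exact this
  have hcard : Fintype.card V = 3 := by
    rw [← F.card_roots, Finset.eq_univ_of_forall hall, Finset.card_univ]
  have hG : G = ⊤ := by
    ext x y
    exact ⟨fun h => h.ne, fun h => F.adj_roots (hall x) (hall y) h⟩
  rw [hcard, cycleGraph_three_eq_top, hG]
  exact ⟨Iso.completeGraph (Fintype.equivFinOfCardEq hcard)⟩

end TriangleForest

end TotalRainbow

/-! ### Assembling the values -/

open TotalRainbow in
theorem theorem3p1 {V : Type*} [Fintype V] (G : SimpleGraph V) (n : ℕ) (hn : Fintype.card V = n)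
    (hconn : G.Connected) (huni : TotalRainbow.IsUnicyclic G)
    (hcyc : ¬ Nonempty (G ≃g SimpleGraph.cycleGraph n))
    (hcirc : TotalRainbow.circumference G = 3) :
    (TotalRainbow.Family5 G → (TotalRainbow.trc G : ℤ) = 2 * n - 5) ∧
    (TotalRainbow.Family6 G → (TotalRainbow.trc G : ℤ) = 2 * n - 6) ∧
    (TotalRainbow.Family7 G → (TotalRainbow.trc G : ℤ) = 2 * n - 7) ∧
    (TotalRainbow.Family8 G → (TotalRainbow.trc G : ℤ) = 2 * n - 8) ∧
    (¬ TotalRainbow.Family5 G ∧ ¬ TotalRainbow.Family6 G ∧ ¬ TotalRainbow.Family7 G ∧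
        ¬ TotalRainbow.Family8 G →
      (TotalRainbow.trc G : ℤ) ≤ 2 * n - 9) := by
  obtain ⟨R, par, dep, F⟩ := exists_triangleForest hconn huni hcirc
  subst hn
  have hE := F.ncard_treeElements
  have hlow := F.ncard_treeElements_le_trc hconn
  have hup := F.trc_le_succ
  have hpos := F.nontrivialRoots_ncard_pos hcyc
  have hle := F.ncard_nontrivialRoots_le
  have hle3 := F.ncard_nontrivialRoots_le_three
  have hB := F.classB_iff huni hcirc
  have hG : ∀ i j, ClassG i j G ↔ (nontrivialRoots G).ncard = i ∧ (leaves G).ncard = j :=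
    fun i j => ⟨fun h => h.2.2, fun h => ⟨huni, hcirc, h⟩⟩
  have hone := F.trc_le_iff_of_one hconn huni hcirc
  have htwo := F.trc_le_iff_of_two hconn
  have hthree : (nontrivialRoots G).ncard = 3 → trc G ≤ (treeElements R par).ncard := by
    intro h
    refine F.trc_le_of_three fun r hr => ?_
    have hsub : nontrivialRoots G ⊆ R := F.nontrivialRoots_eq ▸ Set.inter_subset_left
    have heq := Set.eq_of_subset_of_ncard_le hsub
      (by rw [h, Set.ncard_coe_finset, F.card_roots])
    have : r ∈ nontrivialRoots G := heq ▸ hr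
    rw [F.nontrivialRoots_eq] at this
    exact this.2
  have h13 : ClassG13' G → (nontrivialRoots G).ncard = 1 ∧ (leaves G).ncard = 3 :=
    fun h => (hG 1 3).1 h.1
  simp only [Family5, Family6, Family7, Family8, ClassG13'', ClassG24''', ClassG24', ClassG24'',
    ClassG25', hB, hG]
  -- For each number of nontrivial trees, whether `trc G` is `N` or `N + 1` is now known, so the
  -- claims reduce to arithmetic in the numbers of leaves.
  obtain h | h | h : (nontrivialRoots G).ncard = 1 ∨ (nontrivialRoots G).ncard = 2 ∨
    (nontrivialRoots G).ncard = 3 := by omega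
  · have hone := hone h
    rw [h] at hE hle
    by_cases hc : ClassG13' G
    · have := h13 hc
      simp only [hc, h]
      simp only [hc, not_true_eq_false, and_false, iff_false] at hone
      refine ⟨?_, ?_, ?_, ?_, ?_⟩ <;> intro hfam <;>
        first | omega | simp at hfam
    · simp only [hc, not_false_eq_true, and_true] at hone
      simp only [hc, h, OfNat.one_ne_ofNat, false_and, or_false, true_and, not_false_eq_true,
        and_true]
      refine ⟨?_, ?_, ?_, ?_, ?_⟩ <;> intro hfam <;> first | exact hfam.elim | omega
  · have htwo := htwo h
    have hc : ¬ ClassG13' G := fun hc => by have := (h13 hc).1; omega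
    obtain ⟨u, v, huv, hroots⟩ := Set.ncard_eq_two.1 h
    -- The classes with two nontrivial trees depend only on the two leaf counts, which are positive,
    -- and on which trees are triple brooms.
    have hsum := F.ncard_leaves_of_two hroots huv
    have hu := (Set.ncard_pos (Set.toFinite _)).2
      (F.treeLeaves_nonempty (u := u) (hroots ▸ Or.inl rfl))
    have hv := (Set.ncard_pos (Set.toFinite _)).2
      (F.treeLeaves_nonempty (u := v) (hroots ▸ Or.inr rfl))
    have hbu : IsTripleBroom G u → (treeLeaves G u).ncard = 3 := fun h => h.1
    have hbv : IsTripleBroom G v → (treeLeaves G v).ncard = 3 := fun h => h.1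
    simp only [h, hc]
    rw [h] at hE
    simp only [hroots, Set.mem_insert_iff, Set.mem_singleton_iff, exists_eq_or_imp,
      exists_eq_left, forall_eq_or_imp, forall_eq] at htwo ⊢
    by_cases b1 : IsTripleBroom G u <;> by_cases b2 : IsTripleBroom G v <;>
      simp only [b1, b2, forall_const, not_true_eq_false, not_false_eq_true, and_true, and_false,
        or_false, false_or, or_true, iff_false] at hbu hbv htwo ⊢ <;>
      refine ⟨?_, ?_, ?_, ?_, ?_⟩ <;> intro hfam <;>
      first | omega | (simp at hfam; done) | (simp at hfam; omega)
  · have hthree := hthree h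
    have hc : ¬ ClassG13' G := fun hc => by have := (h13 hc).1; omega
    simp only [h, hc]
    rw [h] at hE hle
    refine ⟨?_, ?_, ?_, ?_, ?_⟩ <;> intro hfam <;>
      first | omega | (simp at hfam; done) | (simp at hfam; omega)
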